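/- Let $n,k\ge 0$ be integers, $T>0$, and let $\Omega\subset\mathbb R^n$ be an open set (for example a bounded domain with Lipschitz boundary). Let $L^2\Lambda^k$ be the Hilbert space of square integrable differential $k$-forms on $\Omega$, let $d$ be the exterior derivative as an unbounded operator $L^2\Lambda^k\to L^2\Lambda^{k+1}$ whose domain $H\Lambda^k$ consists of the $u\in L^2\Lambda^k$ with distributional exterior derivative $du\in L^2\Lambda^{k+1}$, and let $d^*$ be the Hilbert space adjoint of $d$ (with $d^*=0$ on $0$-forms). When $\Omega$ is a bounded Lipschitz domain, $d^*$ is the coderivative restricted to the forms $u$ with $\operatorname{tr}\star u=0$ on $\partial\Omega$. Let $L=dd^*+d^*d$ be the Hodge Laplacian in $L^2\Lambda^k$, with domain $D(L)=\{v\in D(d)\cap D(d^*) : d^*v\in D(d),\ dv\in D(d^*)\}$, and let $D(L^2)=\{v\in D(L): Lv\in D(L)\}$; the spaces $D(L)$ and $D(L^2)$ carry the graph norms of $L$ and $L^2$. Suppose that $u_0\in L^2\Lambda^k$, that $f\in C([0,T];L^2\Lambda^k)$, and that either $f\in L^1((0,T);D(L))$ or $f\in W^{1,1}((0,T);L^2\Lambda^k)$.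 Suppose in addition that $f\in C((0,T];D(L))\cap L^1((0,T);D(L^2))$. Then the problem $$u_t+Lu=f\ \text{ on }(0,T],\qquad u(0)=u_0,$$ has a unique solution $u\in C([0,T];L^2\Lambda^k)\cap C((0,T];D(L))\cap C^1((0,T];L^2\Lambda^k)$, and this solution satisfies $$u\in C^1((0,T];D(L)).$$ -/

import Mathlib

open MeasureTheory Set
open scoped ContDiff

namespace HodgeHeat

noncomputable section

/-- `ℝⁿ` with the Euclidean structure. -/
abbrev Eucl (n : ℕ) : Type := EuclideanSpace ℝ (Fin n)

/-- The `j`-th standard unit vector of `ℝⁿ`. -/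
abbrev unitVec (n : ℕ) (j : Fin n) : Eucl n := EuclideanSpace.basisFun (Fin n) ℝ j

/-- `Altᵏ ℝⁿ`, the space of alternating `k`-linear forms on `ℝⁿ`. -/
abbrev Alt (n k : ℕ) : Type := Eucl n [⋀^Fin k]→ₗ[ℝ] ℝ

/-- The Euclidean inner product of `Altᵏ ℝⁿ`. The sum runs over all `k`-tuples of unit vectors,
so that after division by `k!` the forms `dx_{i₁} ∧ ⋯ ∧ dx_{i_k}`, `i₁ < ⋯ < i_k`, are
orthonormal. -/
def altInner {n k : ℕ} (a b : Alt n k) : ℝ :=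
  ((Nat.factorial k : ℕ) : ℝ)⁻¹ *
    ∑ v : Fin k → Fin n, a (fun i => unitVec n (v i)) * b (fun i => unitVec n (v i))

/-- `altInner` is an inner product. -/
@[reducible] def altCore (n k : ℕ) : InnerProductSpace.Core ℝ (Alt n k) where
  inner a b := altInner a b
  conj_inner_symm a b := by
    simp only [altInner, conj_trivial]
    simp_rw [mul_comm (b _)]
  re_inner_nonneg a := by
    simp only [altInner, RCLike.re_to_real]
    exact mul_nonneg (by positivity) (Finset.sum_nonneg fun _ _ => mul_self_nonneg _)
  add_left a b c := by
    simp only [altInner, AlternatingMap.add_apply, add_mul, Finset.sum_add_distrib, mul_add]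
  smul_left a b r := by
    simp only [altInner, AlternatingMap.smul_apply, smul_eq_mul, conj_trivial, mul_assoc,
      ← Finset.mul_sum]
    ring
  definite a h := by
    have hk : ((Nat.factorial k : ℕ) : ℝ)⁻¹ ≠ 0 := by positivity
    have h0 := (mul_eq_zero.mp h).resolve_left hk
    rw [Finset.sum_eq_zero_iff_of_nonneg (fun _ _ => mul_self_nonneg _)] at h0
    refine Module.Basis.ext_alternating (EuclideanSpace.basisFun (Fin n) ℝ).toBasis
      (fun v _ => ?_)
    simpa using h0 v (Finset.mem_univ v)

instance instNormedAddCommGroupAlt (n k : ℕ) : NormedAddCommGroup (Alt n k) :=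
  @InnerProductSpace.Core.toNormedAddCommGroup ℝ (Alt n k) _ _ _ (altCore n k)

instance instInnerProductSpaceAlt (n k : ℕ) : InnerProductSpace ℝ (Alt n k) :=
  InnerProductSpace.ofCore (altCore n k).toCore

theorem inner_alt {n k : ℕ} (a b : Alt n k) : inner ℝ a b = altInner a b := rfl

instance instFiniteDimensionalAlt (n k : ℕ) : FiniteDimensional ℝ (Alt n k) :=
  Module.Finite.of_injective
    (AlternatingMap.toMultilinearMapLM (R := ℝ) (S := ℝ) (M := Eucl n) (N := ℝ) (ι := Fin k))
    AlternatingMap.coe_multilinearMap_injective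

instance instCompleteSpaceAlt (n k : ℕ) : CompleteSpace (Alt n k) :=
  FiniteDimensional.complete ℝ (Alt n k)

/-- `L²Λᵏ(Ω)`, the Hilbert space of square integrable differential `k`-forms on `Ω`. -/
abbrev L2Form {n : ℕ} (Ω : Set (Eucl n)) (k : ℕ) : Type :=
  Lp (Alt n k) 2 (volume.restrict Ω)

/-- Smooth `k`-forms with compact support in `Ω`. -/
structure IsTestForm {n : ℕ} (Ω : Set (Eucl n)) (k : ℕ) (φ : Eucl n → Alt n k) : Prop where
  smooth : ContDiff ℝ ∞ φ
  compact : HasCompactSupport φ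
  support : tsupport φ ⊆ Ω

/-- The coderivative of a smooth `(k+1)`-form on Euclidean space,
`(δφ)(v₁, …, v_k) = - ∑ⱼ (∂ⱼφ)(eⱼ, v₁, …, v_k)`. -/
def coderiv {n k : ℕ} (φ : Eucl n → Alt n (k + 1)) (x : Eucl n) : Alt n k :=
  -∑ j : Fin n, (fderiv ℝ φ x (unitVec n j)).curryLeft (unitVec n j)

/-- `w` is the distributional exterior derivative of `u` on `Ω`:
`⟨w, φ⟩ = ⟨u, δφ⟩` for all test forms `φ`. -/
def IsWeakExtDeriv {n : ℕ} (Ω : Set (Eucl n)) (k : ℕ)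
    (u : L2Form Ω k) (w : L2Form Ω (k + 1)) : Prop :=
  ∀ φ : Eucl n → Alt n (k + 1), IsTestForm Ω (k + 1) φ →
    (∫ x in Ω, inner ℝ (w x) (φ x)) = ∫ x in Ω, inner ℝ (u x) (coderiv φ x)

theorem IsTestForm.memLp {n k : ℕ} {Ω : Set (Eucl n)} {φ : Eucl n → Alt n k}
    (h : IsTestForm Ω k φ) : MemLp φ 2 (volume.restrict Ω) :=
  (h.smooth.continuous.memLp_of_hasCompactSupport h.compact).restrict Ω

theorem IsTestForm.memLp_coderiv {n k : ℕ} {Ω : Set (Eucl n)} {φ : Eucl n → Alt n (k + 1)}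
    (h : IsTestForm Ω (k + 1) φ) : MemLp (coderiv φ) 2 (volume.restrict Ω) := by
  have hc : Continuous (coderiv φ) := by
    refine (continuous_finsetSum _ fun j _ => ?_).neg
    have h1 : Continuous fun x => fderiv ℝ φ x (unitVec n j) :=
      (h.smooth.continuous_fderiv (by simp)).clm_apply continuous_const
    exact (LinearMap.continuous_of_finiteDimensional
      ((LinearMap.applyₗ (unitVec n j)).comp AlternatingMap.curryLeftLinearMap :
        Alt n (k + 1) →ₗ[ℝ] Alt n k)).comp h1
  have hs : HasCompactSupport (coderiv φ) := by
    refine (h.compact.fderiv ℝ).mono ?_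
    intro x hx hx'
    apply hx
    simp [coderiv, hx']
  exact (hc.memLp_of_hasCompactSupport hs).restrict Ω

theorem integrable_pairing {n m : ℕ} {Ω : Set (Eucl n)} (a : L2Form Ω m) {g : Eucl n → Alt n m}
    (hg : MemLp g 2 (volume.restrict Ω)) :
    Integrable (fun x => inner ℝ (a x) (g x)) (volume.restrict Ω) := by
  refine (L2.integrable_inner (𝕜 := ℝ) a (hg.toLp g)).congr ?_
  filter_upwards [hg.coeFn_toLp] with x hx
  rw [hx]

/-- The graph of the distributional exterior derivative. -/
def extDGraph {n : ℕ} (Ω : Set (Eucl n)) (k : ℕ) :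
    Submodule ℝ (L2Form Ω k × L2Form Ω (k + 1)) where
  carrier := {p | IsWeakExtDeriv Ω k p.1 p.2}
  zero_mem' := by
    intro φ _
    have h1 : ∫ x in Ω, inner ℝ ((0 : L2Form Ω (k + 1)) x) (φ x) = 0 := by
      refine integral_eq_zero_of_ae ?_
      filter_upwards [Lp.coeFn_zero (Alt n (k + 1)) 2 (volume.restrict Ω)] with x hx
      rw [hx]; simp
    have h2 : ∫ x in Ω, inner ℝ ((0 : L2Form Ω k) x) (coderiv φ x) = 0 := by
      refine integral_eq_zero_of_ae ?_
      filter_upwards [Lp.coeFn_zero (Alt n k) 2 (volume.restrict Ω)] with x hx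
      rw [hx]; simp
    exact h1.trans h2.symm
  add_mem' := by
    rintro ⟨u, w⟩ ⟨u', w'⟩ h h' φ hφ
    have key : ∀ {m : ℕ} (a b : L2Form Ω m) (g : Eucl n → Alt n m),
        MemLp g 2 (volume.restrict Ω) →
        ∫ x in Ω, inner ℝ ((a + b : L2Form Ω m) x) (g x) =
          (∫ x in Ω, inner ℝ (a x) (g x)) + ∫ x in Ω, inner ℝ (b x) (g x) := by
      intro m a b g hg
      rw [← integral_add (integrable_pairing a hg) (integrable_pairing b hg)]
      refine integral_congr_ae ?_
      filter_upwards [Lp.coeFn_add a b] with x hx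
      rw [hx, Pi.add_apply, inner_add_left]
    have e : ∫ x in Ω, inner ℝ (w x) (φ x) = ∫ x in Ω, inner ℝ (u x) (coderiv φ x) := h φ hφ
    have e' : ∫ x in Ω, inner ℝ (w' x) (φ x) = ∫ x in Ω, inner ℝ (u' x) (coderiv φ x) := h' φ hφ
    change ∫ x in Ω, inner ℝ ((w + w' : L2Form Ω (k + 1)) x) (φ x) =
      ∫ x in Ω, inner ℝ ((u + u' : L2Form Ω k) x) (coderiv φ x)
    rw [key w w' φ hφ.memLp, key u u' _ hφ.memLp_coderiv, e, e']
  smul_mem' := by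
    rintro c ⟨u, w⟩ h φ hφ
    have key : ∀ {m : ℕ} (a : L2Form Ω m) (g : Eucl n → Alt n m),
        ∫ x in Ω, inner ℝ ((c • a : L2Form Ω m) x) (g x) =
          c * ∫ x in Ω, inner ℝ (a x) (g x) := by
      intro m a g
      rw [← integral_const_mul]
      refine integral_congr_ae ?_
      filter_upwards [Lp.coeFn_smul c a] with x hx
      rw [hx, Pi.smul_apply, real_inner_smul_left]
    have e : ∫ x in Ω, inner ℝ (w x) (φ x) = ∫ x in Ω, inner ℝ (u x) (coderiv φ x) := h φ hφ
    change ∫ x in Ω, inner ℝ ((c • w : L2Form Ω (k + 1)) x) (φ x) =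
      ∫ x in Ω, inner ℝ ((c • u : L2Form Ω k) x) (coderiv φ x)
    rw [key w φ, key u, e]

/-- The distributional exterior derivative is unique. -/
theorem isWeakExtDeriv_zero {n : ℕ} {Ω : Set (Eucl n)} (hΩ : IsOpen Ω) {k : ℕ}
    {w : L2Form Ω (k + 1)} (h : IsWeakExtDeriv Ω k 0 w) : w = 0 := by
  have hloc : LocallyIntegrableOn w Ω volume :=
    locallyIntegrableOn_of_locallyIntegrable_restrict
      ((Lp.memLp w).locallyIntegrable (by norm_num))
  have hz : ∀ᵐ x ∂(volume : Measure (Eucl n)), x ∈ Ω → w x = 0 := by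
    refine hΩ.ae_eq_zero_of_integral_contDiff_smul_eq_zero hloc fun g hg hgc hgs => ?_
    have hT : ∀ c : Alt n (k + 1), IsTestForm Ω (k + 1) (fun x => g x • c) := fun c =>
      ⟨hg.smul contDiff_const, hgc.smul_right, (tsupport_smul_subset_left g _).trans hgs⟩
    rw [← setIntegral_eq_integral_of_forall_compl_eq_zero (s := Ω) (fun x hx => by
      rw [image_eq_zero_of_notMem_tsupport (fun h' => hx (hgs h')), zero_smul])]
    have hint : Integrable (fun x => g x • w x) (volume.restrict Ω) :=
      memLp_one_iff_integrable.1 ((Lp.memLp w).smul (p := 2) (q := 2) (r := 1)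
        ((hg.continuous.memLp_of_hasCompactSupport hgc).restrict Ω))
    refine ext_inner_right ℝ fun c => ?_
    rw [inner_zero_left, real_inner_comm, ← integral_inner hint c]
    have h1 := h _ (hT c)
    have h2 : ∫ x in Ω, inner ℝ ((0 : L2Form Ω k) x) (coderiv (fun x => g x • c) x) = 0 := by
      refine integral_eq_zero_of_ae ?_
      filter_upwards [Lp.coeFn_zero (Alt n k) 2 (volume.restrict Ω)] with x hx
      rw [hx]; simp
    rw [h2] at h1
    rw [← h1]
    refine integral_congr_ae (Filter.Eventually.of_forall fun x => ?_)
    simp only [real_inner_smul_right]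
    rw [real_inner_comm]
  refine (Lp.eq_zero_iff_ae_eq_zero).2 ?_
  exact (ae_restrict_iff' hΩ.measurableSet).2 hz

/-- The exterior derivative `d : L²Λᵏ(Ω) ⊇ HΛᵏ(Ω) → L²Λᵏ⁺¹(Ω)` as an unbounded operator. -/
def extD {n : ℕ} (Ω : Set (Eucl n)) (k : ℕ) : L2Form Ω k →ₗ.[ℝ] L2Form Ω (k + 1) :=
  (extDGraph Ω k).toLinearPMap

theorem mem_extD_graph {n : ℕ} {Ω : Set (Eucl n)} (hΩ : IsOpen Ω) {k : ℕ} (u : L2Form Ω k)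
    (w : L2Form Ω (k + 1)) : (u, w) ∈ (extD Ω k).graph ↔ IsWeakExtDeriv Ω k u w := by
  rw [extD, Submodule.toLinearPMap_graph_eq]
  · rfl
  · rintro ⟨a, b⟩ hab h0
    obtain rfl : a = 0 := h0
    exact isWeakExtDeriv_zero hΩ hab

/-- The adjoint `d* : L²Λᵏ⁺¹(Ω) → L²Λᵏ(Ω)` of `d`, as an unbounded operator. -/
def extDStar {n : ℕ} (Ω : Set (Eucl n)) (k : ℕ) : L2Form Ω (k + 1) →ₗ.[ℝ] L2Form Ω k :=
  (extD Ω k).adjoint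

/-- The composition `g ∘ f` of unbounded operators on its natural domain
`{x ∈ D(f) | f x ∈ D(g)}`. -/
def pcomp {E F G : Type*} [AddCommGroup E] [Module ℝ E] [AddCommGroup F] [Module ℝ F]
    [AddCommGroup G] [Module ℝ G] (g : F →ₗ.[ℝ] G) (f : E →ₗ.[ℝ] F) : E →ₗ.[ℝ] G where
  domain := (g.domain.comap f.toFun).map f.domain.subtype
  toFun := g.toFun.comp ((f.toFun.restrict (q := g.domain) (p := g.domain.comap f.toFun)
    fun _ hx => hx).comp
      (Submodule.equivMapOfInjective f.domain.subtype f.domain.injective_subtype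
        (g.domain.comap f.toFun)).symm.toLinearMap)

theorem mem_pcomp_graph {E F G : Type*} [AddCommGroup E] [Module ℝ E] [AddCommGroup F]
    [Module ℝ F] [AddCommGroup G] [Module ℝ G] (g : F →ₗ.[ℝ] G) (f : E →ₗ.[ℝ] F)
    (x : E) (z : G) :
    (x, z) ∈ (pcomp g f).graph ↔ ∃ y, (x, y) ∈ f.graph ∧ (y, z) ∈ g.graph := by
  simp only [LinearPMap.mem_graph_iff]
  constructor
  · rintro ⟨⟨x', y, hy, rfl⟩, rfl, rfl⟩
    refine ⟨f y, ⟨y, rfl, rfl⟩, ⟨f y, hy⟩, rfl, ?_⟩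
    have : (Submodule.equivMapOfInjective f.domain.subtype f.domain.injective_subtype
        (g.domain.comap f.toFun)).symm ⟨f.domain.subtype y, y, hy, rfl⟩ = ⟨y, hy⟩ := by
      rw [LinearEquiv.symm_apply_eq]; rfl
    exact (congrArg (fun z => g.toFun (f.toFun.restrict (q := g.domain)
      (p := g.domain.comap f.toFun) (fun _ hx => hx) z)) this).symm
  · rintro ⟨y, ⟨a, rfl, rfl⟩, b, hb, rfl⟩
    have ha : a ∈ g.domain.comap f.toFun := by
      change f a ∈ g.domain
      rw [← hb]; exact b.2
    refine ⟨⟨a, a, ha, rfl⟩, rfl, ?_⟩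
    have : (Submodule.equivMapOfInjective f.domain.subtype f.domain.injective_subtype
        (g.domain.comap f.toFun)).symm ⟨f.domain.subtype a, a, ha, rfl⟩ = ⟨a, ha⟩ := by
      rw [LinearEquiv.symm_apply_eq]; rfl
    refine (congrArg (fun z => g.toFun (f.toFun.restrict (q := g.domain)
      (p := g.domain.comap f.toFun) (fun _ hx => hx) z)) this).trans ?_
    exact congrArg g.toFun (Subtype.ext hb.symm)

/-- The part `dd*` of the Hodge Laplacian on `k`-forms; it is `0` for `k = 0`, since there are no
forms of degree `-1`. -/
def extDExtDStar {n : ℕ} (Ω : Set (Eucl n)) : (k : ℕ) → L2Form Ω k →ₗ.[ℝ] L2Form Ω k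
  | 0 => 0
  | k + 1 => pcomp (extD Ω k) (extDStar Ω k)

/-- The Hodge Laplacian `L = dd* + d*d` on `k`-forms, as an unbounded operator in `L²Λᵏ(Ω)`. Its
domain is the set of all `v ∈ D(d) ∩ D(d*)` with `d*v ∈ D(d)` and `dv ∈ D(d*)`. -/
def hodgeLaplacian {n : ℕ} (Ω : Set (Eucl n)) (k : ℕ) : L2Form Ω k →ₗ.[ℝ] L2Form Ω k :=
  extDExtDStar Ω k + pcomp (extDStar Ω k) (extD Ω k)

section Evolution

variable {X : Type*} [NormedAddCommGroup X] [NormedSpace ℝ X]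

/-- The domain `D(A)` of an unbounded operator `A` in `X`, normed by the graph norm: the point
`v ∈ D(A)` is represented by the pair `(v, Av)` in `X × X`, with norm `max ‖v‖ ‖Av‖`. -/
abbrev Dom (A : X →ₗ.[ℝ] X) : Type _ := A.graph

/-- `u ∈ C(J; D(A))`. -/
def MemC (A : X →ₗ.[ℝ] X) (J : Set ℝ) (u : ℝ → X) : Prop :=
  ∃ U : ℝ → Dom A, (∀ t ∈ J, (U t).1.1 = u t) ∧ ContinuousOn U J

/-- `u ∈ C¹(J; D(A))`. -/
def MemC1 (A : X →ₗ.[ℝ] X) (J : Set ℝ) (u : ℝ → X) : Prop :=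
  ∃ U : ℝ → Dom A, (∀ t ∈ J, (U t).1.1 = u t) ∧ ContDiffOn ℝ 1 U J

/-- `u ∈ L¹(J; D(A))`. -/
def MemL1 (A : X →ₗ.[ℝ] X) (J : Set ℝ) (u : ℝ → X) : Prop :=
  ∃ U : ℝ → Dom A, (∀ᵐ t ∂(volume.restrict J), (U t).1.1 = u t) ∧ IntegrableOn U J

/-- `u ∈ W^{1,1}(J; X)` for an open interval `J`. -/
def MemW11 (J : Set ℝ) (u : ℝ → X) : Prop :=
  IntegrableOn u J ∧ ∃ g : ℝ → X, IntegrableOn g J ∧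
    ∀ φ : ℝ → ℝ, ContDiff ℝ ∞ φ → HasCompactSupport φ → tsupport φ ⊆ J →
      (∫ t in J, deriv φ t • u t) = -(∫ t in J, φ t • g t)

/-- `u ∈ C([0,T]; X) ∩ C((0,T]; D(A)) ∩ C¹((0,T]; X)` solves `u_t + Au = f` on `(0,T]`,
`u(0) = u₀`. -/
structure IsSolution (A : X →ₗ.[ℝ] X) (T : ℝ) (f : ℝ → X) (u₀ : X) (u : ℝ → X) : Prop where
  cont : ContinuousOn u (Icc 0 T)
  contDom : MemC A (Ioc 0 T) u
  contDiff : ContDiffOn ℝ 1 u (Ioc 0 T)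
  equation : ∀ t ∈ Ioc 0 T, ∃ h : u t ∈ A.domain,
    derivWithin u (Ioc 0 T) t + A ⟨u t, h⟩ = f t
  initial : u 0 = u₀

end Evolution

end

end HodgeHeat

/-!
The theorem is a statement about one nonnegative self-adjoint operator, the Hodge Laplacian `L`, and
its semigroup `e^{-tL}`.

*Self-adjointness of `L`.* Test forms are dense in `L²Λᵏ` and belong to `D(d)`
(`dense_domain_extD`), and `d` is closed (`isClosed_graph_extD`). Orthogonal decomposition along the
graph of `c • d` gives von Neumann's theorem, that `1 + εd*d` and `1 + εdd*` are onto
(`isNonnegSelfAdjoint_adjoint_comp_self`, `isNonnegSelfAdjoint_self_comp_adjoint`). Since `dd = 0`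
(`extD_extD`), also `(dd*)(d*d) = 0`, so `(1 + εdd*)(1 + εd*d) = 1 + εL`, and `1 + εL` is onto as
well (`IsNonnegSelfAdjoint.add`). Self-adjointness
enters what follows only through symmetry and this range condition.

*The semigroup.* For a nonnegative self-adjoint `A` the exponentials of the bounded Yosida
approximations `A(1 + εA)⁻¹` converge strongly to a contraction semigroup `e^{-tA}`
(`IsNonnegSelfAdjoint.semigroup`). A Lyapunov function bounds `t ‖A e^{-tA} x‖` by `‖x‖`
(`mul_norm_apply_exp_neg_smul_le`), so that `e^{-tA}` maps into `D(A)` for `t > 0`, and by the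
semigroup law the orbit `e^{-tA} u₀` is `C¹` on `(0, ∞)` with values in `D(A)`
(`IsNonnegSelfAdjoint.exists_orbit_derivatives`).

*The inhomogeneous equation.* If `g` and `Ag` are integrable, then the Duhamel integral
`w_g(t) = ∫₀ᵗ e^{-(t-s)A} g(s) ds` is continuous, satisfies `A w_g = w_{Ag}`, and is the integral of
`g - w_{Ag}` (`IsNonnegSelfAdjoint.duhamel_eq_integral`); hence `w_g' = g - w_{Ag}` wherever `g` is
continuous. With `g = f` this gives the equation for `u(t) = e^{-tA} u₀ + w_f(t)`, and with `g = Af`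
it gives the continuous differentiability of `Au`. Both are available because
`f ∈ L¹((0,T); D(A²))` makes `f`, `Af` and `A²f` integrable. Uniqueness is the energy estimate
`(‖z‖²)' = -2⟪Az, z⟫ ≤ 0`.
-/

namespace HodgeHeat

noncomputable section

open Filter Topology

section Abstract

variable {H : Type*} [NormedAddCommGroup H] [InnerProductSpace ℝ H]

/-! ### Resolvents of nonnegative self-adjoint operators -/

/-- An unbounded nonnegative self-adjoint operator `A` on a real Hilbert space. Self-adjointness is
encoded by symmetry together with the range condition `ran (1 + εA) = H` for all `ε > 0`; points of
the graph of `A` are used in place of values of `A`. -/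
structure IsNonnegSelfAdjoint (A : H →ₗ.[ℝ] H) : Prop where
  symm : ∀ {x x' y y' : H}, (x, x') ∈ A.graph → (y, y') ∈ A.graph →
    inner ℝ x' y = inner ℝ x y'
  nonneg : ∀ {x x' : H}, (x, x') ∈ A.graph → 0 ≤ inner ℝ x' x
  range : ∀ ε : ℝ, 0 < ε → ∀ z : H, ∃ p : H × H, p ∈ A.graph ∧ p.1 + ε • p.2 = z

namespace IsNonnegSelfAdjoint

variable {A : H →ₗ.[ℝ] H} (hA : IsNonnegSelfAdjoint A) {ε δ : ℝ}

include hA in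
theorem norm_le_norm_add_smul (hε : 0 < ε) {x x' : H} (h : (x, x') ∈ A.graph) :
    ‖x‖ ≤ ‖x + ε • x'‖ := by
  have h1 : ‖x‖ * ‖x‖ ≤ ‖x + ε • x'‖ * ‖x‖ := by
    refine le_trans ?_ (real_inner_le_norm _ _)
    rw [inner_add_left, real_inner_self_eq_norm_mul_norm, real_inner_smul_left]
    have := mul_nonneg hε.le (hA.nonneg h)
    linarith
  rcases (norm_nonneg x).eq_or_lt with h0 | h0
  · rw [← h0]; positivity
  · exact le_of_mul_le_mul_right h1 h0

include hA in
theorem eq_of_add_smul_eq (hε : 0 < ε) {x x' y y' : H} (h : (x, x') ∈ A.graph)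
    (h' : (y, y') ∈ A.graph) (he : x + ε • x' = y + ε • y') : x = y := by
  have h1 := hA.norm_le_norm_add_smul hε (A.graph.sub_mem h h')
  have h2 : (x - y) + ε • (x' - y') = 0 := by
    rw [smul_sub, sub_add_sub_comm, he, sub_self]
  rw [h2, norm_zero] at h1
  exact sub_eq_zero.1 (norm_le_zero_iff.1 h1)

include hA in
theorem exists_resolvent (hε : 0 < ε) :
    ∃ J : H →L[ℝ] H, ∀ z, (J z, ε⁻¹ • (z - J z)) ∈ A.graph := by
  choose p hp hpz using hA.range ε hε
  refine ⟨LinearMap.mkContinuous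
    { toFun := fun z => (p z).1
      map_add' := fun z w => by
        refine hA.eq_of_add_smul_eq hε (hp (z + w)) (A.graph.add_mem (hp z) (hp w)) ?_
        rw [hpz, smul_add, add_add_add_comm, hpz, hpz]
      map_smul' := fun c z => by
        refine hA.eq_of_add_smul_eq hε (hp (c • z)) (A.graph.smul_mem c (hp z)) ?_
        rw [hpz, RingHom.id_apply, smul_comm ε c, ← smul_add, hpz] }
    1 (fun z => by
      have h1 := hA.norm_le_norm_add_smul hε (hp z)
      rw [hpz] at h1
      simpa using h1), fun z => ?_⟩
  have h2 : ε⁻¹ • (z - (p z).1) = (p z).2 := by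
    rw [inv_smul_eq_iff₀ hε.ne', sub_eq_iff_eq_add', hpz]
  change ((p z).1, ε⁻¹ • (z - (p z).1)) ∈ A.graph
  rw [h2]
  exact hp z

/-- The resolvent `(1 + εA)⁻¹`. -/
def resolvent (hε : 0 < ε) : H →L[ℝ] H := (hA.exists_resolvent hε).choose

theorem resolvent_mem (hε : 0 < ε) (z : H) :
    (hA.resolvent hε z, ε⁻¹ • (z - hA.resolvent hε z)) ∈ A.graph :=
  (hA.exists_resolvent hε).choose_spec z

theorem resolvent_add_smul (hε : 0 < ε) {x x' : H} (h : (x, x') ∈ A.graph) :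
    hA.resolvent hε (x + ε • x') = x := by
  refine hA.eq_of_add_smul_eq hε (hA.resolvent_mem hε _) h ?_
  rw [smul_inv_smul₀ hε.ne', add_sub_cancel]

theorem mem_graph_of_resolvent_eq (hε : 0 < ε) {x x' : H}
    (h : hA.resolvent hε (x + ε • x') = x) : (x, x') ∈ A.graph := by
  have h1 := hA.resolvent_mem hε (x + ε • x')
  rwa [h, add_sub_cancel_left, inv_smul_smul₀ hε.ne'] at h1

theorem norm_resolvent_le (hε : 0 < ε) (z : H) : ‖hA.resolvent hε z‖ ≤ ‖z‖ := by
  have h1 := hA.norm_le_norm_add_smul hε (hA.resolvent_mem hε z)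
  rwa [smul_inv_smul₀ hε.ne', add_sub_cancel] at h1

theorem resolvent_symm (hε : 0 < ε) (z w : H) :
    inner ℝ (hA.resolvent hε z) w = inner ℝ z (hA.resolvent hε w) := by
  obtain ⟨⟨x, x'⟩, hx, rfl⟩ := hA.range ε hε z
  obtain ⟨⟨y, y'⟩, hy, rfl⟩ := hA.range ε hε w
  dsimp only
  rw [hA.resolvent_add_smul hε hx, hA.resolvent_add_smul hε hy, inner_add_left, inner_add_right,
    real_inner_smul_left, real_inner_smul_right, hA.symm hx hy]

theorem resolvent_graph (hε : 0 < ε) {x x' : H} (h : (x, x') ∈ A.graph) :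
    (hA.resolvent hε x, hA.resolvent hε x') ∈ A.graph := by
  have h1 := hA.resolvent_mem hε x
  have h2 : ε⁻¹ • (x - hA.resolvent hε x) = hA.resolvent hε x' := by
    rw [inv_smul_eq_iff₀ hε.ne', sub_eq_iff_eq_add', ← map_smul, ← map_add,
      hA.resolvent_add_smul hε h]
  rwa [h2] at h1

/-- A bounded operator that preserves the graph of `A` commutes with the resolvents of `A`. -/
theorem resolvent_comm_of_graph (hδ : 0 < δ) {B : H →L[ℝ] H}
    (hB : ∀ x x', (x, x') ∈ A.graph → (B x, B x') ∈ A.graph) (z : H) :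
    hA.resolvent hδ (B z) = B (hA.resolvent hδ z) := by
  obtain ⟨⟨x, x'⟩, hx, rfl⟩ := hA.range δ hδ z
  dsimp only
  rw [hA.resolvent_add_smul hδ hx, map_add, map_smul, hA.resolvent_add_smul hδ (hB _ _ hx)]

theorem graph_of_resolvent_comm {B : H →L[ℝ] H}
    (hB : ∀ z, hA.resolvent one_pos (B z) = B (hA.resolvent one_pos z)) {x x' : H}
    (h : (x, x') ∈ A.graph) : (B x, B x') ∈ A.graph := by
  refine hA.mem_graph_of_resolvent_eq one_pos ?_
  rw [one_smul, ← map_add, hB]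
  congr 1
  simpa using hA.resolvent_add_smul one_pos h

include hA in
theorem isClosed_graph : IsClosed (A.graph : Set (H × H)) := by
  have h1 : (A.graph : Set (H × H)) =
      {p | hA.resolvent one_pos (p.1 + p.2) = p.1} := by
    ext ⟨x, x'⟩
    constructor
    · intro h
      simpa using hA.resolvent_add_smul one_pos h
    · intro h
      exact hA.mem_graph_of_resolvent_eq one_pos (by simpa using h)
  rw [h1]
  exact isClosed_eq (by fun_prop) (by fun_prop)

include hA in
theorem dense_domain [CompleteSpace H] : Dense (A.domain : Set H) := by
  rw [Submodule.dense_iff_topologicalClosure_eq_top, Submodule.topologicalClosure_eq_top_iff,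
    Submodule.eq_bot_iff]
  intro x hx
  obtain ⟨⟨y, y'⟩, hy, rfl⟩ := hA.range 1 one_pos x
  dsimp only at hx ⊢
  rw [one_smul] at hx ⊢
  have hyd : y ∈ A.domain := A.mem_domain_of_mem_graph hy
  have h1 : inner ℝ (y + y') y = 0 := (Submodule.mem_orthogonal' _ _).1 hx y hyd
  rw [inner_add_left] at h1
  have h2 : y = 0 := by
    rw [← inner_self_eq_zero (𝕜 := ℝ)]
    linarith [hA.nonneg hy, real_inner_self_nonneg (x := y)]
  subst h2
  rw [zero_add]
  exact A.graph_fst_eq_zero_snd hy rfl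

/-- The Yosida approximation `A(1 + εA)⁻¹ = ε⁻¹(1 - (1 + εA)⁻¹)` of `A`. -/
def yosida (hε : 0 < ε) : H →L[ℝ] H :=
  ε⁻¹ • (ContinuousLinearMap.id ℝ H - hA.resolvent hε)

theorem yosida_apply (hε : 0 < ε) (z : H) :
    hA.yosida hε z = ε⁻¹ • (z - hA.resolvent hε z) := rfl

theorem yosida_eq_resolvent (hε : 0 < ε) {x x' : H} (h : (x, x') ∈ A.graph) :
    hA.yosida hε x = hA.resolvent hε x' :=
  A.mem_graph_snd_inj (hA.resolvent_mem hε x) (hA.resolvent_graph hε h) rfl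

theorem yosida_symm (hε : 0 < ε) (z w : H) :
    inner ℝ (hA.yosida hε z) w = inner ℝ z (hA.yosida hε w) := by
  simp only [yosida_apply, real_inner_smul_left, real_inner_smul_right, inner_sub_left,
    inner_sub_right, hA.resolvent_symm hε z w]

theorem yosida_nonneg (hε : 0 < ε) (z : H) : 0 ≤ inner ℝ (hA.yosida hε z) z := by
  obtain ⟨⟨x, x'⟩, hx, rfl⟩ := hA.range ε hε z
  dsimp only
  rw [yosida_apply, hA.resolvent_add_smul hε hx, add_sub_cancel_left, inv_smul_smul₀ hε.ne',
    inner_add_right, real_inner_smul_right]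
  exact add_nonneg (hA.nonneg hx) (mul_nonneg hε.le real_inner_self_nonneg)

theorem yosida_comm (hε : 0 < ε) (hδ : 0 < δ) :
    Commute (hA.yosida hε) (hA.yosida hδ) := by
  have h1 : Commute (hA.resolvent hε) (hA.resolvent hδ) :=
    ContinuousLinearMap.ext fun z =>
      hA.resolvent_comm_of_graph hε (B := hA.resolvent hδ)
        (fun _ _ h => hA.resolvent_graph hδ h) z
  have h2 : Commute (ContinuousLinearMap.id ℝ H - hA.resolvent hε)
      (ContinuousLinearMap.id ℝ H - hA.resolvent hδ) :=
    Commute.sub_left (Commute.one_left _) (Commute.sub_right (Commute.one_right _) h1)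
  exact (h2.smul_left _).smul_right _

theorem resolvent_comm_yosida (hε : 0 < ε) (hδ : 0 < δ) :
    Commute (hA.resolvent hε) (hA.yosida hδ) := by
  have h1 : Commute (hA.resolvent hε) (hA.resolvent hδ) :=
    ContinuousLinearMap.ext fun z =>
      hA.resolvent_comm_of_graph hε (B := hA.resolvent hδ)
        (fun _ _ h => hA.resolvent_graph hδ h) z
  exact Commute.smul_right (Commute.sub_right (Commute.one_right _) h1) _

include hA in
theorem exists_mem_graph_norm_sub_lt [CompleteSpace H] (x : H) {η : ℝ} (hη : 0 < η) :
    ∃ y y', (y, y') ∈ A.graph ∧ ‖x - y‖ < η := by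
  obtain ⟨y, hy, hxy⟩ := Metric.dense_iff.1 hA.dense_domain x η hη
  exact ⟨y, A ⟨y, hxy⟩, A.mem_graph ⟨y, hxy⟩, by
    rwa [Metric.mem_ball, dist_comm, dist_eq_norm] at hy⟩

include hA in
/-- A family of `2`-Lipschitz deviations that tends to `0` on `D(A)` tends to `0` everywhere. -/
theorem tendsto_zero_of_graph [CompleteSpace H] {ι : Type*} {l : Filter ι} {d : ι → H → ℝ}
    (h0 : ∀ᶠ i in l, ∀ x, 0 ≤ d i x) (h2 : ∀ᶠ i in l, ∀ x y, d i x ≤ 2 * ‖x - y‖ + d i y)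
    (hd : ∀ y y', (y, y') ∈ A.graph → Tendsto (fun i => d i y) l (𝓝 0)) (x : H) :
    Tendsto (fun i => d i x) l (𝓝 0) := by
  rw [Metric.tendsto_nhds]
  intro η hη
  obtain ⟨y, y', hy, hxy⟩ := hA.exists_mem_graph_norm_sub_lt x (η := η / 4) (by positivity)
  filter_upwards [h0, h2, Metric.tendsto_nhds.1 (hd y y' hy) (η / 2) (by positivity)]
    with i hi0 hi2 hi
  rw [Real.dist_eq, sub_zero, abs_of_nonneg (hi0 _)] at hi ⊢
  linarith [hi2 x y]

theorem tendsto_resolvent [CompleteSpace H] (x : H) {e : ℕ → ℝ} (he : ∀ n, 0 < e n)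
    (he0 : Tendsto e atTop (𝓝 0)) :
    Tendsto (fun n => hA.resolvent (he n) x) atTop (𝓝 x) := by
  rw [tendsto_iff_norm_sub_tendsto_zero]
  refine hA.tendsto_zero_of_graph (d := fun n x => ‖hA.resolvent (he n) x - x‖)
    (Eventually.of_forall fun n x => norm_nonneg _)
    (Eventually.of_forall fun n x y => ?_) (fun y y' hy => ?_) x
  · have h1 := hA.norm_resolvent_le (he n) (x - y)
    have h2 : hA.resolvent (he n) x - x =
        hA.resolvent (he n) (x - y) - (x - y) + (hA.resolvent (he n) y - y) := by
      rw [map_sub]; abel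
    rw [h2]
    linarith [norm_add_le (hA.resolvent (he n) (x - y) - (x - y)) (hA.resolvent (he n) y - y),
      norm_sub_le (hA.resolvent (he n) (x - y)) (x - y)]
  · have h1 : ∀ n, ‖hA.resolvent (he n) y - y‖ ≤ e n * ‖y'‖ := fun n => by
      have h2 := hA.resolvent_add_smul (he n) hy
      rw [map_add, map_smul] at h2
      have h3 : hA.resolvent (he n) y - y = -(e n • hA.resolvent (he n) y') := by
        nth_rewrite 2 [← h2]
        abel
      rw [h3, norm_neg, norm_smul, Real.norm_of_nonneg (he n).le]
      exact mul_le_mul_of_nonneg_left (hA.norm_resolvent_le _ _) (he n).le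
    refine squeeze_zero (fun n => norm_nonneg _) h1 ?_
    simpa using he0.mul_const ‖y'‖

theorem tendsto_yosida [CompleteSpace H] {x x' : H} (h : (x, x') ∈ A.graph) {e : ℕ → ℝ}
    (he : ∀ n, 0 < e n) (he0 : Tendsto e atTop (𝓝 0)) :
    Tendsto (fun n => hA.yosida (he n) x) atTop (𝓝 x') := by
  simp only [hA.yosida_eq_resolvent _ h]
  exact hA.tendsto_resolvent x' he he0

theorem norm_yosida_le (hε : 0 < ε) {x x' : H} (h : (x, x') ∈ A.graph) :
    ‖hA.yosida hε x‖ ≤ ‖x'‖ := by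
  rw [hA.yosida_eq_resolvent hε h]
  exact hA.norm_resolvent_le hε x'

end IsNonnegSelfAdjoint

/-! ### The exponential of a bounded nonnegative symmetric operator -/

section Exp

variable [CompleteSpace H] {B : H →L[ℝ] H}

theorem hasDerivAt_exp_neg_smul_apply (B : H →L[ℝ] H) (x : H) (t : ℝ) :
    HasDerivAt (fun t : ℝ => NormedSpace.exp (t • -B) x)
      (-(B (NormedSpace.exp (t • -B) x))) t := by
  have h := (hasDerivAt_exp_smul_const' (𝕂 := ℝ) (-B) t).clm_apply (hasDerivAt_const t x)
  simpa using h

theorem norm_exp_neg_smul_apply_le (hB : ∀ z, 0 ≤ inner ℝ (B z) z) {t : ℝ} (ht : 0 ≤ t) (x : H) :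
    ‖NormedSpace.exp (t • -B) x‖ ≤ ‖x‖ := by
  have hd := fun t => (hasDerivAt_exp_neg_smul_apply B x t).norm_sq
  have h1 : Antitone fun t : ℝ => ‖NormedSpace.exp (t • -B) x‖ ^ 2 := by
    refine antitone_of_deriv_nonpos (fun t => (hd t).differentiableAt) fun t => ?_
    rw [(hd t).deriv, inner_neg_right, real_inner_comm]
    have := hB (NormedSpace.exp (t • -B) x)
    linarith
  have h2 := h1 ht
  simp only [zero_smul, NormedSpace.exp_zero, one_apply_eq_self] at h2
  exact (sq_le_sq₀ (norm_nonneg _) (norm_nonneg _)).1 h2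

/-- The smoothing estimate for `u = exp(-tB) x`, from the Lyapunov function
`‖u‖² + 2t⟪Bu, u⟫ + 2t²‖Bu‖²`, whose derivative is `-4t²⟪B(Bu), Bu⟫`. -/
theorem mul_norm_apply_exp_neg_smul_le (hs : ∀ z w, inner ℝ (B z) w = inner ℝ z (B w))
    (hB : ∀ z, 0 ≤ inner ℝ (B z) z) {t : ℝ} (ht : 0 ≤ t) (x : H) :
    t * ‖B (NormedSpace.exp (t • -B) x)‖ ≤ ‖x‖ := by
  set u : ℝ → H := fun t => NormedSpace.exp (t • -B) x with hu
  have hd : ∀ t, HasDerivAt u (-(B (u t))) t := hasDerivAt_exp_neg_smul_apply B x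
  have hBd : ∀ t, HasDerivAt (fun t => B (u t)) (-(B (B (u t)))) t := fun t => by
    have h := B.hasFDerivAt.comp_hasDerivAt t (hd t)
    rwa [map_neg] at h
  have hE : ∀ t, HasDerivAt
      (fun t => ‖u t‖ ^ 2 + (2 * t) * inner ℝ (B (u t)) (u t) + (2 * t ^ 2) * ‖B (u t)‖ ^ 2)
      (-(4 * t ^ 2 * inner ℝ (B (B (u t))) (B (u t)))) t := fun t => by
    have h1 := (hd t).norm_sq
    have h2 := ((hasDerivAt_id t).const_mul 2).mul ((hBd t).inner ℝ (hd t))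
    have h3 := (((hasDerivAt_id t).pow 2).const_mul 2).mul (hBd t).norm_sq
    refine HasDerivAt.congr_deriv ((h1.add h2).add h3) ?_
    have e1 : inner ℝ (u t) (B (u t)) = inner ℝ (B (u t)) (u t) := real_inner_comm _ _
    have e2 : inner ℝ (B (u t)) (B (B (u t))) = inner ℝ (B (B (u t))) (B (u t)) :=
      real_inner_comm _ _
    simp only [inner_neg_left, inner_neg_right, id_eq, Pi.pow_apply, hs (B (u t)) (u t), e1, e2,
      ← real_inner_self_eq_norm_sq]
    ring
  have h1 : Antitone fun t =>
      ‖u t‖ ^ 2 + (2 * t) * inner ℝ (B (u t)) (u t) + (2 * t ^ 2) * ‖B (u t)‖ ^ 2 := by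
    refine antitone_of_deriv_nonpos (fun t => (hE t).differentiableAt) fun t => ?_
    rw [(hE t).deriv]
    have := mul_nonneg (by positivity : 0 ≤ 4 * t ^ 2) (hB (B (u t)))
    linarith
  have h2 := h1 ht
  have h0 : u 0 = x := by simp [hu]
  simp only [h0] at h2
  have h3 := mul_nonneg (by positivity : 0 ≤ 2 * t) (hB (u t))
  refine (sq_le_sq₀ (by positivity) (norm_nonneg _)).1 ?_
  nlinarith [sq_nonneg ‖u t‖, sq_nonneg (t * ‖B (u t)‖)]

/-- Exponentials of commuting bounded nonnegative operators depend on the generator in a Lipschitz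
way, pointwise in `x`. -/
theorem norm_exp_sub_exp_apply_le {C : H →L[ℝ] H} (hB : ∀ z, 0 ≤ inner ℝ (B z) z)
    (hC : ∀ z, 0 ≤ inner ℝ (C z) z) (hBC : Commute B C) {t : ℝ} (ht : 0 ≤ t) (x : H) :
    ‖NormedSpace.exp (t • -B) x - NormedSpace.exp (t • -C) x‖ ≤ t * ‖B x - C x‖ := by
  set v : ℝ → H := fun s => NormedSpace.exp (s • -B) (NormedSpace.exp ((t - s) • -C) x) with hv
  have hd : ∀ s, HasDerivAt v
      (NormedSpace.exp (s • -B) (NormedSpace.exp ((t - s) • -C) (C x - B x))) s := fun s => by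
    have h1 := hasDerivAt_exp_smul_const' (𝕂 := ℝ) (-B) s
    have h2 := HasDerivAt.scomp s (g₁ := fun t : ℝ => NormedSpace.exp (t • -C) x)
      (hasDerivAt_exp_neg_smul_apply C x (t - s)) ((hasDerivAt_id s).const_sub t)
    have h3 := h1.clm_apply h2
    refine HasDerivAt.congr_deriv (f := v) h3 ?_
    have c1 : Commute B (NormedSpace.exp (s • -B)) :=
      (((Commute.refl B).neg_right).smul_right s).exp_right
    have c2 : Commute B (NormedSpace.exp ((t - s) • -C)) :=
      ((hBC.neg_right).smul_right (t - s)).exp_right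
    have c3 : Commute C (NormedSpace.exp ((t - s) • -C)) :=
      (((Commute.refl C).neg_right).smul_right (t - s)).exp_right
    have e1 : ∀ z, B (NormedSpace.exp (s • -B) z) = NormedSpace.exp (s • -B) (B z) :=
      fun z => DFunLike.congr_fun c1.eq z
    have e2 : ∀ z, B (NormedSpace.exp ((t - s) • -C) z) = NormedSpace.exp ((t - s) • -C) (B z) :=
      fun z => DFunLike.congr_fun c2.eq z
    have e3 : ∀ z, C (NormedSpace.exp ((t - s) • -C) z) = NormedSpace.exp ((t - s) • -C) (C z) :=
      fun z => DFunLike.congr_fun c3.eq z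
    change (-B) (NormedSpace.exp (s • -B) (NormedSpace.exp ((t - s) • -C) x)) +
      NormedSpace.exp (s • -B) ((-1 : ℝ) • -(C (NormedSpace.exp ((t - s) • -C) x))) = _
    rw [neg_apply, e1, e2, e3, neg_one_smul, neg_neg, map_sub, map_sub]
    abel
  have h1 := norm_image_sub_le_of_norm_deriv_le_segment' (f := v) (C := ‖B x - C x‖) (a := 0)
    (b := t) (fun s _ => (hd s).hasDerivWithinAt) (fun s hs => by
      refine (norm_exp_neg_smul_apply_le hB hs.1 _).trans ?_
      refine (norm_exp_neg_smul_apply_le hC (sub_nonneg.2 hs.2.le) _).trans ?_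
      rw [norm_sub_rev]) t ⟨ht, le_rfl⟩
  simpa [hv, mul_comm] using h1

end Exp

namespace IsNonnegSelfAdjoint

/-! ### The semigroup generated by a nonnegative self-adjoint operator -/

section Semigroup

variable [CompleteSpace H] {A : H →ₗ.[ℝ] H} (hA : IsNonnegSelfAdjoint A)

/-- The approximation `exp(-tA_ε)` of the semigroup, with `A_ε` the Yosida approximation of `A` for
`ε = 1/(n+1)`. -/
def approx (n : ℕ) (t : ℝ) : H →L[ℝ] H :=
  NormedSpace.exp (t • -hA.yosida (Nat.one_div_pos_of_nat (α := ℝ) (n := n)))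

theorem norm_approx_le (n : ℕ) {t : ℝ} (ht : 0 ≤ t) (x : H) : ‖hA.approx n t x‖ ≤ ‖x‖ :=
  norm_exp_neg_smul_apply_le (hA.yosida_nonneg _) ht x

omit [CompleteSpace H] in
theorem approx_apply_yosida (n : ℕ) (t : ℝ) (x : H) :
    hA.approx n t (hA.yosida (Nat.one_div_pos_of_nat (α := ℝ) (n := n)) x) =
      hA.yosida (Nat.one_div_pos_of_nat (α := ℝ) (n := n)) (hA.approx n t x) :=
  (DFunLike.congr_fun ((((Commute.refl (hA.yosida
    (Nat.one_div_pos_of_nat (α := ℝ) (n := n)))).neg_right).smul_right t).exp_right).eq x).symm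

omit [CompleteSpace H] in
theorem resolvent_approx (n : ℕ) (t : ℝ) {ε : ℝ} (hε : 0 < ε) (x : H) :
    hA.resolvent hε (hA.approx n t x) = hA.approx n t (hA.resolvent hε x) :=
  DFunLike.congr_fun
    ((((hA.resolvent_comm_yosida hε _).neg_right).smul_right t).exp_right).eq x

theorem cauchySeq_approx {t : ℝ} (ht : 0 ≤ t) (x : H) : CauchySeq fun n => hA.approx n t x := by
  rw [cauchySeq_iff_tendsto_dist_atTop_0]
  simp only [dist_eq_norm]
  refine hA.tendsto_zero_of_graph
    (d := fun (p : ℕ × ℕ) x => ‖hA.approx p.1 t x - hA.approx p.2 t x‖)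
    (Eventually.of_forall fun p x => norm_nonneg _)
    (Eventually.of_forall fun p x y => ?_) (fun y y' hy => ?_) x
  · have h : hA.approx p.1 t x - hA.approx p.2 t x = (hA.approx p.1 t (x - y) -
        hA.approx p.2 t (x - y)) + (hA.approx p.1 t y - hA.approx p.2 t y) := by
      simp only [map_sub]; abel
    rw [h]
    linarith [norm_add_le (hA.approx p.1 t (x - y) - hA.approx p.2 t (x - y))
      (hA.approx p.1 t y - hA.approx p.2 t y),
      norm_sub_le (hA.approx p.1 t (x - y)) (hA.approx p.2 t (x - y)),
      hA.norm_approx_le p.1 ht (x - y), hA.norm_approx_le p.2 ht (x - y)]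
  · have h1 := (hA.tendsto_yosida hy (fun n => Nat.one_div_pos_of_nat (α := ℝ) (n := n))
      tendsto_one_div_add_atTop_nhds_zero_nat).cauchySeq
    rw [cauchySeq_iff_tendsto_dist_atTop_0] at h1
    refine squeeze_zero (fun p => norm_nonneg _) (fun p => ?_)
      (by simpa only [mul_zero] using h1.const_mul t)
    rw [dist_eq_norm]
    have e1 := Nat.one_div_pos_of_nat (α := ℝ) (n := p.1)
    have e2 := Nat.one_div_pos_of_nat (α := ℝ) (n := p.2)
    exact norm_exp_sub_exp_apply_le (hA.yosida_nonneg e1) (hA.yosida_nonneg e2)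
      (hA.yosida_comm e1 e2) ht y

theorem exists_semigroup : ∃ S : ℝ → H →L[ℝ] H,
    ∀ t x, Tendsto (fun n => hA.approx n (max t 0) x) atTop (𝓝 (S t x)) := by
  choose S hS using fun (t : ℝ) (x : H) =>
    cauchySeq_tendsto_of_complete (hA.cauchySeq_approx (le_max_right t 0) x)
  refine ⟨fun t => LinearMap.mkContinuous
    { toFun := S t
      map_add' := fun x y => tendsto_nhds_unique (hS t (x + y)) (by
        simpa only [map_add] using (hS t x).add (hS t y))
      map_smul' := fun c x => tendsto_nhds_unique (hS t (c • x)) (by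
        simpa only [map_smul, RingHom.id_apply] using (hS t x).const_smul c) } 1 (fun x => ?_), hS⟩
  rw [one_mul]
  exact le_of_tendsto (hS t x).norm
    (Eventually.of_forall fun n => hA.norm_approx_le n (le_max_right t 0) x)

/-- The semigroup `e^{-tA}`, for `t ≥ 0`. For `t ≤ 0` its value is the identity, which makes it
continuous on the whole line. -/
def semigroup : ℝ → H →L[ℝ] H := hA.exists_semigroup.choose

theorem tendsto_approx_max (t : ℝ) (x : H) :
    Tendsto (fun n => hA.approx n (max t 0) x) atTop (𝓝 (hA.semigroup t x)) :=
  hA.exists_semigroup.choose_spec t x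

theorem tendsto_approx {t : ℝ} (ht : 0 ≤ t) (x : H) :
    Tendsto (fun n => hA.approx n t x) atTop (𝓝 (hA.semigroup t x)) := by
  simpa only [max_eq_left ht] using hA.tendsto_approx_max t x

theorem semigroup_of_nonpos {t : ℝ} (ht : t ≤ 0) (x : H) : hA.semigroup t x = x := by
  refine tendsto_nhds_unique (hA.tendsto_approx_max t x) ?_
  simp [max_eq_right ht, approx]

theorem norm_semigroup_le (t : ℝ) (x : H) : ‖hA.semigroup t x‖ ≤ ‖x‖ :=
  le_of_tendsto (hA.tendsto_approx_max t x).norm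
    (Eventually.of_forall fun n => hA.norm_approx_le n (le_max_right t 0) x)

theorem tendsto_approx_of_tendsto {t : ℝ} (ht : 0 ≤ t) {x : H} {y : ℕ → H}
    (hy : Tendsto y atTop (𝓝 x)) :
    Tendsto (fun n => hA.approx n t (y n)) atTop (𝓝 (hA.semigroup t x)) := by
  have h1 : Tendsto (fun n => hA.approx n t (y n - x)) atTop (𝓝 0) :=
    squeeze_zero_norm (fun n => hA.norm_approx_le n ht _)
      (tendsto_iff_norm_sub_tendsto_zero.1 hy)
  simpa only [map_sub, sub_add_cancel, zero_add] using h1.add (hA.tendsto_approx ht x)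

theorem semigroup_add {s t : ℝ} (hs : 0 ≤ s) (ht : 0 ≤ t) (x : H) :
    hA.semigroup (s + t) x = hA.semigroup s (hA.semigroup t x) := by
  refine tendsto_nhds_unique (hA.tendsto_approx (add_nonneg hs ht) x) ?_
  refine (hA.tendsto_approx_of_tendsto hs (hA.tendsto_approx ht x)).congr fun n => ?_
  have h : hA.approx n (s + t) = hA.approx n s * hA.approx n t := by
    rw [approx, add_smul]
    let _ : NormedAlgebra ℚ (H →L[ℝ] H) := NormedAlgebra.restrictScalars ℚ ℝ _
    exact NormedSpace.exp_add_of_commute (((Commute.refl _).smul_left s).smul_right t)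
  rw [h]; rfl

theorem resolvent_semigroup {ε : ℝ} (hε : 0 < ε) (t : ℝ) (x : H) :
    hA.resolvent hε (hA.semigroup t x) = hA.semigroup t (hA.resolvent hε x) := by
  refine tendsto_nhds_unique
    (((hA.resolvent hε).continuous.tendsto _).comp (hA.tendsto_approx_max t x)) ?_
  refine (hA.tendsto_approx_max t (hA.resolvent hε x)).congr fun n => ?_
  exact (hA.resolvent_approx n _ hε x).symm

theorem semigroup_graph (t : ℝ) {x x' : H} (h : (x, x') ∈ A.graph) :
    (hA.semigroup t x, hA.semigroup t x') ∈ A.graph :=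
  hA.graph_of_resolvent_comm (hA.resolvent_semigroup one_pos t) h

theorem norm_semigroup_sub_le (s t : ℝ) {x x' : H} (h : (x, x') ∈ A.graph) :
    ‖hA.semigroup t x - hA.semigroup s x‖ ≤ ‖x'‖ * |t - s| := by
  refine le_of_tendsto ((hA.tendsto_approx_max t x).sub (hA.tendsto_approx_max s x)).norm
    (Eventually.of_forall fun n => ?_)
  have h1 := Convex.norm_image_sub_le_of_norm_hasDerivWithin_le (s := Ici (0 : ℝ))
    (f := fun t => hA.approx n t x) (C := ‖x'‖)
    (fun t _ => (hasDerivAt_exp_neg_smul_apply _ x t).hasDerivWithinAt) (fun t ht => by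
      rw [norm_neg]
      have h2 := hA.approx_apply_yosida n t x
      rw [approx] at h2
      rw [← h2]
      exact (hA.norm_approx_le n ht _).trans (hA.norm_yosida_le _ h))
    (convex_Ici 0) (le_max_right s 0) (le_max_right t 0)
  refine h1.trans (mul_le_mul_of_nonneg_left ?_ (norm_nonneg _))
  rw [Real.norm_eq_abs]
  exact abs_max_sub_max_le_abs t s 0

theorem continuous_semigroup (x : H) : Continuous fun t => hA.semigroup t x := by
  refine continuous_iff_continuousAt.2 fun s => ?_
  rw [ContinuousAt, tendsto_iff_norm_sub_tendsto_zero]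
  refine hA.tendsto_zero_of_graph
    (d := fun t x => ‖hA.semigroup t x - hA.semigroup s x‖)
    (Eventually.of_forall fun t x => norm_nonneg _)
    (Eventually.of_forall fun t x y => ?_) (fun y y' hy => ?_) x
  · have h : hA.semigroup t x - hA.semigroup s x = (hA.semigroup t (x - y) -
        hA.semigroup s (x - y)) + (hA.semigroup t y - hA.semigroup s y) := by
      simp only [map_sub]; abel
    rw [h]
    linarith [norm_add_le (hA.semigroup t (x - y) - hA.semigroup s (x - y))
      (hA.semigroup t y - hA.semigroup s y),
      norm_sub_le (hA.semigroup t (x - y)) (hA.semigroup s (x - y)),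
      hA.norm_semigroup_le t (x - y), hA.norm_semigroup_le s (x - y)]
  · refine squeeze_zero (fun t => norm_nonneg _)
      (fun t => hA.norm_semigroup_sub_le s t hy) ?_
    have : Continuous fun t : ℝ => ‖y'‖ * |t - s| := by fun_prop
    simpa using this.tendsto s

theorem continuous_semigroup_uncurry : Continuous fun p : ℝ × H => hA.semigroup p.1 p.2 := by
  refine continuous_iff_continuousAt.2 fun ⟨s, x⟩ => ?_
  rw [ContinuousAt, tendsto_iff_norm_sub_tendsto_zero]
  have h1 : Continuous fun p : ℝ × H => ‖p.2 - x‖ + ‖hA.semigroup p.1 x - hA.semigroup s x‖ :=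
    (by fun_prop : Continuous fun p : ℝ × H => ‖p.2 - x‖).add
      (((hA.continuous_semigroup x).comp continuous_fst).sub continuous_const).norm
  refine squeeze_zero (fun p => norm_nonneg _) (fun p => ?_)
    (by simpa using h1.tendsto (s, x))
  have h : hA.semigroup p.1 p.2 - hA.semigroup s x =
      hA.semigroup p.1 (p.2 - x) + (hA.semigroup p.1 x - hA.semigroup s x) := by
    simp only [map_sub]; abel
  rw [h]
  exact (norm_add_le _ _).trans (add_le_add_left (hA.norm_semigroup_le _ _) _)

theorem semigroup_eq_sub_integral {t : ℝ} (ht : 0 ≤ t) {x x' : H} (h : (x, x') ∈ A.graph) :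
    hA.semigroup t x = x - ∫ r in (0 : ℝ)..t, hA.semigroup r x' := by
  have hY := hA.tendsto_yosida h (fun n => Nat.one_div_pos_of_nat (α := ℝ) (n := n))
    tendsto_one_div_add_atTop_nhds_zero_nat
  have hd : ∀ n r, HasDerivAt (fun r => hA.approx n r x)
      (-(hA.approx n r (hA.yosida (Nat.one_div_pos_of_nat (α := ℝ) (n := n)) x))) r :=
    fun n r => by
      rw [approx_apply_yosida]
      exact hasDerivAt_exp_neg_smul_apply _ x r
  have hc : ∀ n y, Continuous fun r => hA.approx n r y := fun n y =>
    continuous_iff_continuousAt.2 fun r => (hasDerivAt_exp_neg_smul_apply _ y r).continuousAt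
  have h1 : ∀ n, hA.approx n t x = x - ∫ r in (0 : ℝ)..t,
      hA.approx n r (hA.yosida (Nat.one_div_pos_of_nat (α := ℝ) (n := n)) x) := fun n => by
    have h2 := intervalIntegral.integral_eq_sub_of_hasDerivAt (a := 0) (b := t)
      (fun r _ => hd n r) ((hc n _).neg.intervalIntegrable 0 t)
    rw [intervalIntegral.integral_neg] at h2
    have h3 : hA.approx n 0 x = x := by simp [approx]
    rw [h3] at h2
    rw [sub_eq_add_neg, h2]; abel
  have h2 : Tendsto (fun n => ∫ r in (0 : ℝ)..t,
      hA.approx n r (hA.yosida (Nat.one_div_pos_of_nat (α := ℝ) (n := n)) x)) atTop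
      (𝓝 (∫ r in (0 : ℝ)..t, hA.semigroup r x')) := by
    refine intervalIntegral.tendsto_integral_filter_of_dominated_convergence (fun _ => ‖x'‖)
      (Eventually.of_forall fun n => (hc n _).aestronglyMeasurable)
      (Eventually.of_forall fun n => Eventually.of_forall fun r hr => ?_)
      intervalIntegrable_const (Eventually.of_forall fun r hr => ?_)
    · rw [uIoc_of_le ht] at hr
      exact (hA.norm_approx_le n hr.1.le _).trans (hA.norm_yosida_le _ h)
    · rw [uIoc_of_le ht] at hr
      exact hA.tendsto_approx_of_tendsto hr.1.le hY
  refine tendsto_nhds_unique (hA.tendsto_approx ht x) ?_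
  simp only [h1]
  exact tendsto_const_nhds.sub h2

theorem hasDerivAt_semigroup {t : ℝ} (ht : 0 < t) {x x' : H} (h : (x, x') ∈ A.graph) :
    HasDerivAt (fun t => hA.semigroup t x) (-(hA.semigroup t x')) t := by
  have h1 : HasDerivAt (fun t => x - ∫ r in (0 : ℝ)..t, hA.semigroup r x')
      (-(hA.semigroup t x')) t := by
    have h2 := (intervalIntegral.integral_hasDerivAt_right (a := 0) (b := t)
      ((hA.continuous_semigroup x').intervalIntegrable 0 t)
      (hA.continuous_semigroup x').aestronglyMeasurable.stronglyMeasurableAtFilter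
      (hA.continuous_semigroup x').continuousAt)
    exact h2.const_sub x
  refine h1.congr_of_eventuallyEq ?_
  filter_upwards [lt_mem_nhds ht] with s hs
  exact hA.semigroup_eq_sub_integral hs.le h

theorem mul_norm_semigroup_le {t : ℝ} (ht : 0 ≤ t) {x x' : H} (h : (x, x') ∈ A.graph) :
    t * ‖hA.semigroup t x'‖ ≤ ‖x‖ := by
  have hY := hA.tendsto_yosida h (fun n => Nat.one_div_pos_of_nat (α := ℝ) (n := n))
    tendsto_one_div_add_atTop_nhds_zero_nat
  refine le_of_tendsto ((hA.tendsto_approx_of_tendsto ht hY).norm.const_mul t)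
    (Eventually.of_forall fun n => ?_)
  rw [approx_apply_yosida]
  exact mul_norm_apply_exp_neg_smul_le (hA.yosida_symm _) (hA.yosida_nonneg _) ht x

/-- The semigroup maps the whole space into `D(A)` at positive times: on `D(A)` the map
`x ↦ A e^{-tA} x` is bounded by `1/t`, so it extends by density since `A` is closed. -/
theorem semigroup_mem_domain {t : ℝ} (ht : 0 < t) (x : H) : hA.semigroup t x ∈ A.domain := by
  choose y y' hy hxy using fun n : ℕ =>
    hA.exists_mem_graph_norm_sub_lt x (Nat.one_div_pos_of_nat (α := ℝ) (n := n))
  have hyx : Tendsto y atTop (𝓝 x) := by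
    rw [tendsto_iff_norm_sub_tendsto_zero]
    refine squeeze_zero (fun n => norm_nonneg _) (fun n => ?_)
      (tendsto_one_div_add_atTop_nhds_zero_nat (𝕜 := ℝ))
    rw [norm_sub_rev]
    exact (hxy n).le
  have hC : CauchySeq fun n => hA.semigroup t (y' n) := by
    rw [cauchySeq_iff_tendsto_dist_atTop_0]
    have h1 := cauchySeq_iff_tendsto_dist_atTop_0.1 hyx.cauchySeq
    refine squeeze_zero (fun p => dist_nonneg) (fun p => ?_) (by simpa using h1.const_mul t⁻¹)
    rw [dist_eq_norm, dist_eq_norm, ← map_sub, le_inv_mul_iff₀ ht]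
    exact hA.mul_norm_semigroup_le ht.le (A.graph.sub_mem (hy _) (hy _))
  obtain ⟨z, hz⟩ := cauchySeq_tendsto_of_complete hC
  have h2 : (hA.semigroup t x, z) ∈ A.graph :=
    hA.isClosed_graph.mem_of_tendsto
      ((((hA.semigroup t).continuous.tendsto x).comp hyx).prodMk_nhds hz)
      (Eventually.of_forall fun n => hA.semigroup_graph t (hy n))
  exact A.mem_domain_of_mem_graph h2

/-- For every `x`, the orbit `e^{-tA} x` is `C²` on `(0, ∞)`, and its derivatives are `-A e^{-tA} x`
and `A² e^{-tA} x`. -/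
theorem exists_orbit_derivatives (x : H) : ∃ a b : ℝ → H,
    (∀ t, 0 < t → (hA.semigroup t x, a t) ∈ A.graph) ∧
    (∀ t, 0 < t → HasDerivAt (fun t => hA.semigroup t x) (-(a t)) t) ∧
    (∀ t, 0 < t → HasDerivAt a (-(b t)) t) ∧ ContinuousOn b (Ioi 0) := by
  have key : ∀ t : ℝ, ∃ p : H × H, 0 < t →
      (hA.semigroup t x, p.1) ∈ A.graph ∧ (p.1, p.2) ∈ A.graph := fun t => by
    by_cases ht : 0 < t
    · have ht2 : 0 < t / 2 := half_pos ht
      have h1 := A.mem_graph ⟨_, hA.semigroup_mem_domain ht2 x⟩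
      have h2 := hA.semigroup_graph (t / 2) h1
      rw [← hA.semigroup_add ht2.le ht2.le, add_halves] at h2
      exact ⟨(_, _), fun _ => ⟨h2, A.mem_graph ⟨_, hA.semigroup_mem_domain ht2 _⟩⟩⟩
    · exact ⟨0, fun h => absurd h ht⟩
  choose p hp using key
  have hshift : ∀ s t, 0 < s → s ≤ t → hA.semigroup t x = hA.semigroup (t - s) (hA.semigroup s x) ∧
      (p t).1 = hA.semigroup (t - s) (p s).1 ∧ (p t).2 = hA.semigroup (t - s) (p s).2 :=
    fun s t hs hst => by
      have h0 : hA.semigroup t x = hA.semigroup (t - s) (hA.semigroup s x) := by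
        rw [← hA.semigroup_add (sub_nonneg.2 hst) hs.le, sub_add_cancel]
      have h1 := A.mem_graph_snd_inj (hp t (hs.trans_le hst)).1
        (hA.semigroup_graph (t - s) (hp s hs).1) h0
      exact ⟨h0, h1, A.mem_graph_snd_inj (hp t (hs.trans_le hst)).2
        (hA.semigroup_graph (t - s) (hp s hs).2) h1⟩
  have hd : ∀ t, 0 < t → ∀ (F : ℝ → H) (y y' : H), (y, y') ∈ A.graph →
      (∀ r, t / 2 ≤ r → F r = hA.semigroup (r - t / 2) y) →
      HasDerivAt F (-(hA.semigroup (t - t / 2) y')) t := fun t ht F y y' hy hF => by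
    have h1 := (hA.hasDerivAt_semigroup (t := t - t / 2) (by linarith) hy).comp_sub_const t (t / 2)
    refine h1.congr_of_eventuallyEq ?_
    filter_upwards [lt_mem_nhds (half_lt_self ht)] with r hr
    exact hF r hr.le
  refine ⟨fun t => (p t).1, fun t => (p t).2, fun t ht => (hp t ht).1, fun t ht => ?_,
    fun t ht => ?_, fun t ht => ?_⟩
  · beta_reduce
    rw [(hshift (t / 2) t (half_pos ht) (half_le_self ht.le)).2.1]
    exact hd t ht _ _ _ (hp _ (half_pos ht)).1 fun r hr => (hshift _ r (half_pos ht) hr).1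
  · beta_reduce
    rw [(hshift (t / 2) t (half_pos ht) (half_le_self ht.le)).2.2]
    exact hd t ht _ _ _ (hp _ (half_pos ht)).2 fun r hr => (hshift _ r (half_pos ht) hr).2.1
  · refine ContinuousAt.continuousWithinAt ?_
    have ht' : 0 < t := ht
    have h1 : ContinuousAt (fun r => hA.semigroup (r - t / 2) (p (t / 2)).2) t :=
      ((hA.continuous_semigroup _).comp (continuous_id.sub continuous_const)).continuousAt
    refine h1.congr ?_
    filter_upwards [lt_mem_nhds (half_lt_self ht')] with r hr
    exact (hshift (t / 2) r (half_pos ht') hr.le).2.2.symm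

end Semigroup

end IsNonnegSelfAdjoint

/-! ### Duhamel integrals -/

/-- The fundamental theorem of calculus on `(0, T]`, one-sided at `T`, for an integrand that is
integrable on `(0, T)` but continuous only away from `0`. -/
theorem hasDerivWithinAt_integral_Ioc [CompleteSpace H] {T : ℝ} {q : ℝ → H}
    (hq : IntervalIntegrable q volume 0 T) (hc : ContinuousOn q (Ioc 0 T)) {t : ℝ}
    (ht : t ∈ Ioc 0 T) :
    HasDerivWithinAt (fun t => ∫ s in (0 : ℝ)..t, q s) (q t) (Ioc 0 T) t := by
  have hT : 0 < T := ht.1.trans_le ht.2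
  -- Extending `q` by `q T` to the right of `T` turns the endpoint into an interior point.
  set p : ℝ → H := fun s => q (min s T) with hp
  have hpq : ∀ s, s ≤ T → p s = q s := fun s hs => by rw [hp]; simp only [min_eq_left hs]
  have hpc : ContinuousOn p (Ioi 0) :=
    hc.comp (by fun_prop) fun s hs => ⟨lt_min hs hT, min_le_right _ _⟩
  have hpi : IntervalIntegrable p volume 0 t := by
    refine (hq.mono_set (c := 0) (d := t) ?_).congr ?_
    · rw [uIcc_of_le hT.le, uIcc_of_le ht.1.le]
      exact Icc_subset_Icc_right ht.2
    · intro s hs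
      rw [uIoc_of_le ht.1.le] at hs
      exact (hpq s (hs.2.trans ht.2)).symm
  have h1 := intervalIntegral.integral_hasDerivAt_right hpi
    (hpc.stronglyMeasurableAtFilter isOpen_Ioi t ht.1) (hpc.continuousAt (Ioi_mem_nhds ht.1))
  rw [hpq t ht.2] at h1
  have h2 : ∀ x ∈ Ioc 0 T, ∫ s in (0 : ℝ)..x, q s = ∫ s in (0 : ℝ)..x, p s := fun x hx => by
    refine intervalIntegral.integral_congr fun s hs => ?_
    rw [uIcc_of_le hx.1.le] at hs
    exact (hpq s (hs.2.trans hx.2)).symm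
  exact h1.hasDerivWithinAt.congr h2 (h2 t ht)

theorem intervalIntegrable_left {E : Type*} [NormedAddCommGroup E] {T : ℝ} {g : ℝ → E}
    (hg : IntervalIntegrable g volume 0 T) {t : ℝ}
    (ht : t ∈ Icc 0 T) : IntervalIntegrable g volume 0 t :=
  hg.mono_set (by
    rw [uIcc_of_le (ht.1.trans ht.2), uIcc_of_le ht.1]
    exact Icc_subset_Icc_right ht.2)

namespace IsNonnegSelfAdjoint

section Duhamel

variable [CompleteSpace H] {A : H →ₗ.[ℝ] H} (hA : IsNonnegSelfAdjoint A) {T : ℝ} {g g' : ℝ → H}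

/-- The Duhamel integral `∫₀ᵗ e^{-(t-s)A} g(s) ds`. -/
def duhamel (g : ℝ → H) (t : ℝ) : H := ∫ s in (0 : ℝ)..t, hA.semigroup (t - s) (g s)

theorem intervalIntegrable_semigroup {a b : ℝ} (hg : IntervalIntegrable g volume a b) (t : ℝ) :
    IntervalIntegrable (fun s => hA.semigroup (t - s) (g s)) volume a b := by
  refine hg.mono_fun ?_ (Eventually.of_forall fun s => hA.norm_semigroup_le _ _)
  exact hA.continuous_semigroup_uncurry.comp_aestronglyMeasurable
    ((continuous_const.sub continuous_id).aestronglyMeasurable.prodMk hg.def'.aestronglyMeasurable)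

theorem duhamel_zero : hA.duhamel g 0 = 0 := intervalIntegral.integral_same

theorem continuousOn_duhamel (hT : 0 ≤ T) (hg : IntervalIntegrable g volume 0 T) :
    ContinuousOn (hA.duhamel g) (Icc 0 T) := by
  -- The semigroup is the identity at negative times, so the integral over `(0, t)` is the
  -- integral of the same kernel over `(0, T)` minus `∫ₜᵀ g`.
  have h1 : ∀ t ∈ Icc 0 T, hA.duhamel g t = (∫ s in (0 : ℝ)..T, hA.semigroup (t - s) (g s)) -
      ((∫ s in (0 : ℝ)..T, g s) - ∫ s in (0 : ℝ)..t, g s) := fun t ht => by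
    have hg0 := intervalIntegrable_left hg ht
    have hg1 : IntervalIntegrable g volume t T := hg0.symm.trans hg
    rw [intervalIntegral.integral_interval_sub_left hg hg0,
      ← intervalIntegral.integral_add_adjacent_intervals
        (hA.intervalIntegrable_semigroup hg0 t) (hA.intervalIntegrable_semigroup hg1 t)]
    have h2 : ∫ s in t..T, hA.semigroup (t - s) (g s) = ∫ s in t..T, g s := by
      refine intervalIntegral.integral_congr fun s hs => ?_
      rw [uIcc_of_le ht.2] at hs
      exact hA.semigroup_of_nonpos (sub_nonpos.2 hs.1) _
    rw [h2, add_sub_cancel_right, duhamel]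
  refine ContinuousOn.congr ?_ h1
  refine ContinuousOn.sub ?_ (continuousOn_const.sub ?_)
  · refine Continuous.continuousOn ?_
    refine intervalIntegral.continuous_of_dominated_interval (bound := fun s => ‖g s‖)
      (fun t => (hA.intervalIntegrable_semigroup hg t).def'.aestronglyMeasurable)
      (fun t => Eventually.of_forall fun s _ => hA.norm_semigroup_le _ _) hg.norm
      (Eventually.of_forall fun s _ => ?_)
    exact (hA.continuous_semigroup (g s)).comp (continuous_id.sub continuous_const)
  · have := intervalIntegral.continuousOn_primitive_interval' hg left_mem_uIcc
    rwa [uIcc_of_le hT] at this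

theorem duhamel_graph (hg : IntervalIntegrable g volume 0 T)
    (hg' : IntervalIntegrable g' volume 0 T)
    (h : ∀ᵐ t, t ∈ Ioc 0 T → (g t, g' t) ∈ A.graph) {t : ℝ} (ht : t ∈ Icc 0 T) :
    (hA.duhamel g t, hA.duhamel g' t) ∈ A.graph := by
  have hg0 := hA.intervalIntegrable_semigroup (intervalIntegrable_left hg ht) t
  have hg0' := hA.intervalIntegrable_semigroup (intervalIntegrable_left hg' ht) t
  refine hA.mem_graph_of_resolvent_eq one_pos ?_
  rw [one_smul, duhamel, duhamel, ← intervalIntegral.integral_add hg0 hg0',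
    ← ContinuousLinearMap.intervalIntegral_comp_comm _ (hg0.add hg0')]
  refine intervalIntegral.integral_congr_ae ?_
  filter_upwards [h] with s hs hst
  rw [uIoc_of_le ht.1] at hst
  rw [← map_add, hA.resolvent_semigroup]
  congr 1
  simpa using hA.resolvent_add_smul one_pos (hs ⟨hst.1, hst.2.trans ht.2⟩)

/-- The Duhamel integral is the integral of the formal derivative
`g(t) - A ∫₀ᵗ e^{-(t-s)A} g(s) ds`: write `e^{-(t-s)A} g(s)` as the integral of its derivative and
exchange the order of integration. -/
theorem duhamel_eq_integral (hg : IntervalIntegrable g volume 0 T)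
    (hg' : IntervalIntegrable g' volume 0 T)
    (h : ∀ᵐ t, t ∈ Ioc 0 T → (g t, g' t) ∈ A.graph) {t : ℝ} (ht : t ∈ Icc 0 T) :
    hA.duhamel g t = (∫ s in (0 : ℝ)..t, g s) - ∫ s in (0 : ℝ)..t, hA.duhamel g' s := by
  have hg0 := intervalIntegrable_left hg ht
  have hg0' := intervalIntegrable_left hg' ht
  set F : ℝ → ℝ → H := fun s r => ({p : ℝ × ℝ | p.1 ≤ p.2}.indicator
    (fun p => hA.semigroup (p.2 - p.1) (g' p.1))) (s, r) with hF
  have hFint : Integrable (Function.uncurry F)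
      ((volume.restrict (Ioc 0 t)).prod (volume.restrict (Ioc 0 t))) := by
    have hgi : Integrable g' (volume.restrict (Ioc 0 t)) := hg0'.1
    refine (hgi.norm.comp_fst (volume.restrict (Ioc 0 t))).mono' ?_
      (Eventually.of_forall fun p => ?_)
    · refine AEStronglyMeasurable.indicator ?_ (measurableSet_le measurable_fst measurable_snd)
      exact hA.continuous_semigroup_uncurry.comp_aestronglyMeasurable
        ((continuous_snd.sub continuous_fst).aestronglyMeasurable.prodMk
          hgi.aestronglyMeasurable.comp_fst)
    · exact (norm_indicator_le_norm_self (fun p : ℝ × ℝ => hA.semigroup (p.2 - p.1) (g' p.1))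
        p).trans (hA.norm_semigroup_le _ _)
  have hswap := integral_integral_swap hFint
  have hr : ∫ s in (0 : ℝ)..t, hA.duhamel g' s =
      ∫ r in Ioc 0 t, ∫ s in Ioc 0 t, F s r := by
    rw [intervalIntegral.integral_of_le ht.1]
    refine setIntegral_congr_fun measurableSet_Ioc fun r hr => ?_
    have h1 : ∀ s, F s r = (Iic r).indicator (fun s => hA.semigroup (r - s) (g' s)) s :=
      fun s => by simp [hF, indicator_apply]
    simp only [h1]
    rw [setIntegral_indicator measurableSet_Iic, Ioc_inter_Iic, min_eq_right hr.2, duhamel,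
      intervalIntegral.integral_of_le hr.1.le]
  have hs : ∫ s in (0 : ℝ)..t, (g s - hA.semigroup (t - s) (g s)) =
      ∫ s in Ioc 0 t, ∫ r in Ioc 0 t, F s r := by
    rw [intervalIntegral.integral_of_le ht.1]
    refine setIntegral_congr_ae measurableSet_Ioc ?_
    filter_upwards [h] with s hs hst
    have h1 : ∀ r, F s r = (Ici s).indicator (fun r => hA.semigroup (r - s) (g' s)) r :=
      fun r => by simp [hF, indicator_apply]
    simp only [h1]
    have h2 : Ioc 0 t ∩ Ici s = Icc s t := by
      ext r
      simp only [mem_inter_iff, mem_Ioc, mem_Ici, mem_Icc]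
      exact ⟨fun h => ⟨h.2, h.1.2⟩, fun h => ⟨⟨hst.1.trans_le h.1, h.2⟩, h.1⟩⟩
    rw [setIntegral_indicator measurableSet_Ici, h2, integral_Icc_eq_integral_Ioc,
      ← intervalIntegral.integral_of_le hst.2,
      intervalIntegral.integral_comp_sub_right (fun r => hA.semigroup r (g' s)) s, sub_self,
      hA.semigroup_eq_sub_integral (sub_nonneg.2 hst.2) (hs ⟨hst.1, hst.2.trans ht.2⟩),
      sub_sub_cancel]
  rw [hr, ← hswap, ← hs, intervalIntegral.integral_sub hg0
    (hA.intervalIntegrable_semigroup hg0 t), sub_sub_cancel, duhamel]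

/-- If `g` is continuous on `(0, T]`, then its Duhamel integral solves the inhomogeneous equation
there. -/
theorem hasDerivWithinAt_duhamel (hT : 0 ≤ T) (hg : IntervalIntegrable g volume 0 T)
    (hg' : IntervalIntegrable g' volume 0 T)
    (h : ∀ᵐ t, t ∈ Ioc 0 T → (g t, g' t) ∈ A.graph) (hc : ContinuousOn g (Ioc 0 T)) {t : ℝ}
    (ht : t ∈ Ioc 0 T) :
    HasDerivWithinAt (hA.duhamel g) (g t - hA.duhamel g' t) (Ioc 0 T) t := by
  have hw := hA.continuousOn_duhamel hT hg'
  have hwi : IntervalIntegrable (hA.duhamel g') volume 0 T := by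
    refine ContinuousOn.intervalIntegrable ?_
    rwa [uIcc_of_le hT]
  have h1 := (hasDerivWithinAt_integral_Ioc hg hc ht).sub
    (hasDerivWithinAt_integral_Ioc hwi (hw.mono Ioc_subset_Icc_self) ht)
  exact h1.congr (fun s hs => hA.duhamel_eq_integral hg hg' h (Ioc_subset_Icc_self hs))
    (hA.duhamel_eq_integral hg hg' h (Ioc_subset_Icc_self ht))

end Duhamel

end IsNonnegSelfAdjoint

/-! ### The inhomogeneous heat equation for a nonnegative self-adjoint operator -/

theorem contDiffOn_one_Ioc_of_hasDerivWithinAt {T : ℝ} {p p' : ℝ → H}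
    (h : ∀ t ∈ Ioc 0 T, HasDerivWithinAt p (p' t) (Ioc 0 T) t) (hc : ContinuousOn p' (Ioc 0 T)) :
    ContDiffOn ℝ 1 p (Ioc 0 T) := by
  have hu : UniqueDiffOn ℝ (Ioc 0 T) := uniqueDiffOn_Ioc 0 T
  rw [contDiffOn_one_iff_derivWithin hu]
  exact ⟨fun t ht => (h t ht).differentiableWithinAt,
    hc.congr fun t ht => (h t ht).derivWithin (hu t ht)⟩

namespace IsNonnegSelfAdjoint

variable {A : H →ₗ.[ℝ] H} (hA : IsNonnegSelfAdjoint A) {T : ℝ}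

/-- The bounded isomorphism `z ↦ ((1 + A)⁻¹ z, A (1 + A)⁻¹ z)` of `H` onto `D(A)` with the graph
norm. -/
def toDom : H →L[ℝ] Dom A :=
  ((hA.resolvent one_pos).prod (ContinuousLinearMap.id ℝ H - hA.resolvent one_pos)).codRestrict
    A.graph fun z => by
      have h := hA.resolvent_mem one_pos z
      rwa [inv_one, one_smul] at h

theorem toDom_fst {x x' : H} (h : (x, x') ∈ A.graph) : (hA.toDom (x + x')).1.1 = x := by
  have h1 := hA.resolvent_add_smul one_pos h
  rwa [one_smul] at h1

include hA in
/-- Uniqueness: the square norm of the difference of two solutions is nonincreasing. -/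
theorem isSolution_unique {f : ℝ → H} {u₀ : H} {u v : ℝ → H} (hu : IsSolution A T f u₀ u)
    (hv : IsSolution A T f u₀ v) : EqOn v u (Icc 0 T) := by
  have hder : ∀ {w : ℝ → H}, IsSolution A T f u₀ w → ∀ t ∈ Ioo 0 T,
      HasDerivAt w (derivWithin w (Ioc 0 T) t) t := fun hw t ht =>
    ((hw.contDiff.differentiableOn one_ne_zero t
      (Ioo_subset_Ioc_self ht)).hasDerivWithinAt).hasDerivAt (Ioc_mem_nhds ht.1 ht.2)
  have hz : ∀ t ∈ Ioo 0 T, HasDerivAt (fun t => ‖v t - u t‖ ^ 2)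
      (2 * inner ℝ (v t - u t) (derivWithin v (Ioc 0 T) t - derivWithin u (Ioc 0 T) t)) t :=
    fun t ht => ((hder hv t ht).sub (hder hu t ht)).norm_sq
  have hanti : AntitoneOn (fun t => ‖v t - u t‖ ^ 2) (Icc 0 T) := by
    refine antitoneOn_of_deriv_nonpos (convex_Icc 0 T) ((hv.cont.sub hu.cont).norm.pow 2) ?_ ?_
    · rw [interior_Icc]
      exact fun t ht => (hz t ht).differentiableAt.differentiableWithinAt
    · rw [interior_Icc]
      intro t ht
      obtain ⟨hu1, hu2⟩ := hu.equation t (Ioo_subset_Ioc_self ht)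
      obtain ⟨hv1, hv2⟩ := hv.equation t (Ioo_subset_Ioc_self ht)
      have h1 := hA.nonneg (A.graph.sub_mem (A.mem_graph ⟨_, hv1⟩) (A.mem_graph ⟨_, hu1⟩))
      have h2 : derivWithin v (Ioc 0 T) t - derivWithin u (Ioc 0 T) t =
          -(A ⟨v t, hv1⟩ - A ⟨u t, hu1⟩) := by
        rw [eq_sub_of_add_eq hv2, eq_sub_of_add_eq hu2]; abel
      rw [(hz t ht).deriv, h2, inner_neg_right, real_inner_comm]
      linarith
  intro t ht
  have h1 := hanti ⟨le_rfl, ht.1.trans ht.2⟩ ht ht.1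
  simp only [hv.initial, hu.initial, sub_self, norm_zero] at h1
  have h2 : ‖v t - u t‖ = 0 := by
    have := norm_nonneg (v t - u t)
    nlinarith
  exact sub_eq_zero.1 (norm_eq_zero.1 h2)

include hA in
/-- If `f ∈ C((0,T]; D(A)) ∩ L¹((0,T); D(A²))`, then `Af ∈ C((0,T]; H)`, and `f`, `Af`, `A²f` are
integrable. Integrability of `Af` follows from the resolvent formula
`Af = f - (1 + A)⁻¹(f - A²f)`. -/
theorem exists_apply_integrable [CompleteSpace H] (hT : 0 < T) {f : ℝ → H}
    (hf : ContinuousOn f (Icc 0 T)) (hfC : MemC A (Ioc 0 T) f)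
    (hfL : MemL1 (pcomp A A) (Ioo 0 T) f) : ∃ f₁ f₂ : ℝ → H,
      (∀ t ∈ Ioc 0 T, (f t, f₁ t) ∈ A.graph) ∧ ContinuousOn f₁ (Ioc 0 T) ∧
      (∀ᵐ t, t ∈ Ioc 0 T → (f₁ t, f₂ t) ∈ A.graph) ∧
      IntervalIntegrable f volume 0 T ∧ IntervalIntegrable f₁ volume 0 T ∧
      IntervalIntegrable f₂ volume 0 T := by
  obtain ⟨U, hU, hUc⟩ := hfC
  obtain ⟨V, hV, hVi⟩ := hfL
  have hUg : ∀ t ∈ Ioc 0 T, (f t, (U t).1.2) ∈ A.graph := fun t ht => by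
    rw [← hU t ht]; exact (U t).2
  have hVg : ∀ᵐ t ∂(volume.restrict (Ioo 0 T)), ((U t).1.2, (V t).1.2) ∈ A.graph := by
    filter_upwards [hV, ae_restrict_mem measurableSet_Ioo] with t ht htT
    obtain ⟨y, hy, hy'⟩ := (mem_pcomp_graph A A _ _).1 (V t).2
    rwa [A.mem_graph_snd_inj hy (hUg t (Ioo_subset_Ioc_self htT)) ht] at hy'
  have hfi : IntervalIntegrable f volume 0 T :=
    ContinuousOn.intervalIntegrable (by rwa [uIcc_of_le hT.le])
  have hf2 : IntervalIntegrable (fun t => (V t).1.2) volume 0 T := by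
    rw [intervalIntegrable_iff_integrableOn_Ioo_of_le hT.le]
    exact ((ContinuousLinearMap.snd ℝ H H).comp
      (pcomp A A).graph.subtypeL).integrable_comp hVi
  have hf1 : IntervalIntegrable (fun t => (U t).1.2) volume 0 T := by
    have h1 : IntegrableOn (fun t => f t - hA.resolvent one_pos (f t - (V t).1.2)) (Ioo 0 T) := by
      rw [intervalIntegrable_iff_integrableOn_Ioo_of_le hT.le] at hfi hf2
      exact hfi.sub ((hA.resolvent one_pos).integrable_comp (hfi.sub hf2))
    rw [intervalIntegrable_iff_integrableOn_Ioo_of_le hT.le]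
    refine Integrable.congr h1 ?_
    filter_upwards [hVg, ae_restrict_mem measurableSet_Ioo] with t ht htT
    have h2 := hA.resolvent_add_smul one_pos
      (A.graph.sub_mem (hUg t (Ioo_subset_Ioc_self htT)) ht)
    rw [one_smul] at h2
    dsimp only at h2
    rw [sub_add_sub_cancel] at h2
    rw [h2, sub_sub_cancel]
  refine ⟨fun t => (U t).1.2, fun t => (V t).1.2, hUg, ?_, ?_, hfi, hf1, hf2⟩
  · exact (continuous_snd.comp continuous_subtype_val).comp_continuousOn hUc
  · rw [← ae_restrict_iff' measurableSet_Ioc, ← restrict_Ioo_eq_restrict_Ioc]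
    exact hVg

include hA in
/-- Well-posedness of `u' + Au = f` with a solution in `C¹((0,T]; D(A))`. The solution is
`u(t) = e^{-tA} u₀ + ∫₀ᵗ e^{-(t-s)A} f(s) ds`. -/
theorem exists_solution_contDiffOn [CompleteSpace H] (hT : 0 < T) (u₀ : H) {f : ℝ → H}
    (hf : ContinuousOn f (Icc 0 T)) (hfC : MemC A (Ioc 0 T) f)
    (hfL : MemL1 (pcomp A A) (Ioo 0 T) f) :
    ∃ u : ℝ → H, IsSolution A T f u₀ u ∧
      (∀ v : ℝ → H, IsSolution A T f u₀ v → EqOn v u (Icc 0 T)) ∧ MemC1 A (Ioc 0 T) u := by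
  obtain ⟨f₁, f₂, h01, hc1, h12, hi0, hi1, hi2⟩ := hA.exists_apply_integrable hT hf hfC hfL
  obtain ⟨a, b, hag, had, hbd, hbc⟩ := hA.exists_orbit_derivatives u₀
  have h01' : ∀ᵐ t, t ∈ Ioc 0 T → (f t, f₁ t) ∈ A.graph := Eventually.of_forall h01
  have hc0 : ContinuousOn f (Ioc 0 T) := hf.mono Ioc_subset_Icc_self
  set u : ℝ → H := fun t => hA.semigroup t u₀ + hA.duhamel f t with hu
  set u₁ : ℝ → H := fun t => a t + hA.duhamel f₁ t with hu₁
  have hcw : ∀ {g : ℝ → H}, IntervalIntegrable g volume 0 T →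
      ContinuousOn (hA.duhamel g) (Ioc 0 T) := fun hg =>
    (hA.continuousOn_duhamel hT.le hg).mono Ioc_subset_Icc_self
  have hac : ContinuousOn a (Ioc 0 T) := fun t ht =>
    (hbd t ht.1).continuousAt.continuousWithinAt
  have hgraph : ∀ t ∈ Ioc 0 T, (u t, u₁ t) ∈ A.graph := fun t ht =>
    A.graph.add_mem (hag t ht.1) (hA.duhamel_graph hi0 hi1 h01' (Ioc_subset_Icc_self ht))
  have hud : ∀ t ∈ Ioc 0 T, HasDerivWithinAt u (-(a t) + (f t - hA.duhamel f₁ t)) (Ioc 0 T) t :=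
    fun t ht => (had t ht.1).hasDerivWithinAt.add
      (hA.hasDerivWithinAt_duhamel hT.le hi0 hi1 h01' hc0 ht)
  have hu₁d : ∀ t ∈ Ioc 0 T,
      HasDerivWithinAt u₁ (-(b t) + (f₁ t - hA.duhamel f₂ t)) (Ioc 0 T) t :=
    fun t ht => (hbd t ht.1).hasDerivWithinAt.add
      (hA.hasDerivWithinAt_duhamel hT.le hi1 hi2 h12 hc1 ht)
  have huC : ContDiffOn ℝ 1 u (Ioc 0 T) :=
    contDiffOn_one_Ioc_of_hasDerivWithinAt hud (hac.neg.add (hc0.sub (hcw hi1)))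
  have hu₁C : ContDiffOn ℝ 1 u₁ (Ioc 0 T) :=
    contDiffOn_one_Ioc_of_hasDerivWithinAt hu₁d
      ((hbc.mono Ioc_subset_Ioi_self).neg.add (hc1.sub (hcw hi2)))
  have hC1 : ContDiffOn ℝ 1 (fun t => hA.toDom (u t + u₁ t)) (Ioc 0 T) :=
    hA.toDom.contDiff.comp_contDiffOn (huC.add hu₁C)
  have hdom : ∀ t ∈ Ioc 0 T, (hA.toDom (u t + u₁ t)).1.1 = u t := fun t ht =>
    hA.toDom_fst (hgraph t ht)
  have hsol : IsSolution A T f u₀ u :=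
    { cont := (hA.continuous_semigroup u₀).continuousOn.add (hA.continuousOn_duhamel hT.le hi0)
      contDom := ⟨_, hdom, hC1.continuousOn⟩
      contDiff := huC
      equation := fun t ht => by
        refine ⟨A.mem_domain_of_mem_graph (hgraph t ht), ?_⟩
        rw [A.mem_graph_snd_inj (A.mem_graph ⟨u t, A.mem_domain_of_mem_graph (hgraph t ht)⟩)
          (hgraph t ht) rfl, (hud t ht).derivWithin (uniqueDiffOn_Ioc 0 T t ht)]
        simp only [hu₁]
        abel
      initial := by
        simp only [hu, hA.semigroup_of_nonpos le_rfl, duhamel_zero, add_zero] }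
  exact ⟨u, hsol, fun v hv => hA.isSolution_unique hsol hv, _, hdom, hC1⟩

end IsNonnegSelfAdjoint

/-! ### The operators `T*T` and `TT*` -/

section VonNeumann

variable {E F : Type*} [NormedAddCommGroup E] [InnerProductSpace ℝ E] [CompleteSpace E]
  [NormedAddCommGroup F] [InnerProductSpace ℝ F] {T : E →ₗ.[ℝ] F}

theorem mem_graph_adjoint (hT : Dense (T.domain : Set E)) {y : F} {w : E} :
    (y, w) ∈ T.adjoint.graph ↔ ∀ x x', (x, x') ∈ T.graph → inner ℝ w x = inner ℝ y x' := by
  constructor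
  · intro h x x' hx
    obtain ⟨y, rfl, rfl⟩ := (T.adjoint.mem_graph_iff).1 h
    obtain ⟨x, rfl, rfl⟩ := (T.mem_graph_iff).1 hx
    exact LinearPMap.adjoint_isFormalAdjoint hT y x
  · intro h
    have h1 : ∀ x : T.domain, inner ℝ w (x : E) = inner ℝ y (T x) := fun x =>
      h _ _ (T.mem_graph x)
    have h2 : y ∈ T.adjoint.domain := LinearPMap.mem_adjoint_domain_of_exists y ⟨w, h1⟩
    rw [LinearPMap.mem_graph_iff]
    exact ⟨⟨y, h2⟩, rfl, LinearPMap.adjoint_apply_eq hT _ h1⟩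

/-- The orthogonal decomposition of `(f, g)` in `E × F` along the closed graph of `c • T`; its
orthogonal complement consists of the pairs `(-T*(c q), q)`. -/
theorem exists_graph_adjoint_decomposition [CompleteSpace F] (hT : Dense (T.domain : Set E))
    (hTc : IsClosed (T.graph : Set (E × F))) {c : ℝ} (hc : c ≠ 0) (f : E) (g : F) :
    ∃ v y, (v, y) ∈ T.graph ∧ (c • (g - c • y), v - f) ∈ T.adjoint.graph := by
  set Φ : WithLp 2 (E × F) →L[ℝ] E × F :=
    ((ContinuousLinearMap.fst ℝ E F).prod (c⁻¹ • ContinuousLinearMap.snd ℝ E F)).comp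
      (WithLp.prodContinuousLinearEquiv 2 ℝ E F).toContinuousLinearMap with hΦ
  have hΦa : ∀ z, Φ z = (z.fst, c⁻¹ • z.snd) := fun z => rfl
  set K : Submodule ℝ (WithLp 2 (E × F)) := T.graph.comap Φ.toLinearMap with hK
  have hKc : IsClosed (K : Set (WithLp 2 (E × F))) := hTc.preimage Φ.continuous
  have : CompleteSpace K := hKc.completeSpace_coe
  set z : WithLp 2 (E × F) := WithLp.toLp 2 (f, g) with hz
  set p := K.starProjection z with hp
  have hpK : p ∈ K := K.starProjection_apply_mem z
  have hort : z - p ∈ Kᗮ := K.sub_starProjection_mem_orthogonal z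
  have hp2 : p.snd = c • c⁻¹ • p.snd := (smul_inv_smul₀ hc _).symm
  refine ⟨p.fst, c⁻¹ • p.snd, hpK, (mem_graph_adjoint hT).2 fun x x' hx => ?_⟩
  have hxK : (WithLp.toLp 2 (x, c • x') : WithLp 2 (E × F)) ∈ K := by
    change Φ _ ∈ T.graph
    rw [hΦa]
    simpa [inv_smul_smul₀ hc] using hx
  have h1 := (K.mem_orthogonal' _).1 hort _ hxK
  rw [WithLp.prod_inner_apply] at h1
  change inner ℝ (f - p.fst) x + inner ℝ (g - p.snd) (c • x') = 0 at h1
  rw [← hp2, real_inner_smul_left]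
  rw [real_inner_smul_right, ← neg_sub, inner_neg_left] at h1
  linarith

/-- Von Neumann's theorem: `T*T` is nonnegative and self-adjoint if `T` is closed and densely
defined. -/
theorem isNonnegSelfAdjoint_adjoint_comp_self [CompleteSpace F] (hT : Dense (T.domain : Set E))
    (hTc : IsClosed (T.graph : Set (E × F))) : IsNonnegSelfAdjoint (pcomp T.adjoint T) where
  symm {x x' y y'} hx hy := by
    obtain ⟨a, hxa, hax⟩ := (mem_pcomp_graph _ _ _ _).1 hx
    obtain ⟨b, hyb, hby⟩ := (mem_pcomp_graph _ _ _ _).1 hy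
    rw [(mem_graph_adjoint hT).1 hax _ _ hyb, ← real_inner_comm x y',
      (mem_graph_adjoint hT).1 hby _ _ hxa, real_inner_comm]
  nonneg {x x'} hx := by
    obtain ⟨a, hxa, hax⟩ := (mem_pcomp_graph _ _ _ _).1 hx
    rw [(mem_graph_adjoint hT).1 hax _ _ hxa]
    exact real_inner_self_nonneg
  range ε hε z := by
    have hc : √ε ≠ 0 := (Real.sqrt_pos.2 hε).ne'
    obtain ⟨v, y, hv, hy⟩ := exists_graph_adjoint_decomposition hT hTc hc z 0
    have h1 := T.adjoint.graph.smul_mem (-ε⁻¹) hy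
    rw [Prod.smul_mk, zero_sub, smul_neg, smul_smul (√ε), Real.mul_self_sqrt hε.le, neg_smul,
      smul_neg, neg_neg, inv_smul_smul₀ hε.ne'] at h1
    refine ⟨(v, -ε⁻¹ • (v - z)), (mem_pcomp_graph _ _ _ _).2 ⟨y, hv, h1⟩, ?_⟩
    dsimp only
    rw [neg_smul, smul_neg, smul_inv_smul₀ hε.ne']
    abel

/-- Von Neumann's theorem for `TT*`. -/
theorem isNonnegSelfAdjoint_self_comp_adjoint [CompleteSpace F] (hT : Dense (T.domain : Set E))
    (hTc : IsClosed (T.graph : Set (E × F))) : IsNonnegSelfAdjoint (pcomp T T.adjoint) where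
  symm {x x' y y'} hx hy := by
    obtain ⟨a, hxa, hax⟩ := (mem_pcomp_graph _ _ _ _).1 hx
    obtain ⟨b, hyb, hby⟩ := (mem_pcomp_graph _ _ _ _).1 hy
    rw [real_inner_comm, ← (mem_graph_adjoint hT).1 hyb _ _ hax,
      ← (mem_graph_adjoint hT).1 hxa _ _ hby, real_inner_comm]
  nonneg {x x'} hx := by
    obtain ⟨a, hxa, hax⟩ := (mem_pcomp_graph _ _ _ _).1 hx
    rw [real_inner_comm, ← (mem_graph_adjoint hT).1 hxa _ _ hax]
    exact real_inner_self_nonneg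
  range ε hε z := by
    have hc : √ε ≠ 0 := (Real.sqrt_pos.2 hε).ne'
    obtain ⟨v, y, hv, hy⟩ := exists_graph_adjoint_decomposition hT hTc hc 0 z
    have h1 := T.adjoint.graph.smul_mem (√ε)⁻¹ hy
    rw [Prod.smul_mk, inv_smul_smul₀ hc, sub_zero] at h1
    refine ⟨(z - √ε • y, (√ε)⁻¹ • y),
      (mem_pcomp_graph _ _ _ _).2 ⟨(√ε)⁻¹ • v, h1, T.graph.smul_mem _ hv⟩, ?_⟩
    dsimp only
    rw [smul_smul, ← div_eq_mul_inv, Real.div_sqrt, sub_add_cancel]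

end VonNeumann

theorem mem_graph_add {P Q : H →ₗ.[ℝ] H} {x z : H} :
    (x, z) ∈ (P + Q).graph ↔ ∃ a b, (x, a) ∈ P.graph ∧ (x, b) ∈ Q.graph ∧ a + b = z := by
  simp only [LinearPMap.mem_graph_iff]
  constructor
  · rintro ⟨y, rfl, rfl⟩
    exact ⟨_, _, ⟨⟨y, y.2.1⟩, rfl, rfl⟩, ⟨⟨y, y.2.2⟩, rfl, rfl⟩, rfl⟩
  · rintro ⟨a, b, ⟨p, rfl, rfl⟩, ⟨q, hq, rfl⟩, rfl⟩
    obtain ⟨q, hq'⟩ := q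
    obtain rfl : q = p := hq
    exact ⟨⟨p, p.2, hq'⟩, rfl, rfl⟩

theorem isNonnegSelfAdjoint_zero : IsNonnegSelfAdjoint (0 : H →ₗ.[ℝ] H) := by
  have h : ∀ {x x' : H}, (x, x') ∈ (0 : H →ₗ.[ℝ] H).graph ↔ x' = 0 := fun {x x'} => by
    rw [LinearPMap.mem_graph_iff]
    constructor
    · rintro ⟨y, -, rfl⟩; rfl
    · rintro rfl; exact ⟨⟨x, trivial⟩, rfl, rfl⟩
  exact
    { symm := fun hx hy => by rw [h.1 hx, h.1 hy, inner_zero_left, inner_zero_right]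
      nonneg := fun hx => by rw [h.1 hx, inner_zero_left]
      range := fun ε _ z => ⟨(z, 0), h.2 rfl, by simp⟩ }

/-- If `PQ = 0`, then the sum of the nonnegative self-adjoint operators `P` and `Q` is self-adjoint,
since `(1 + εP)(1 + εQ) = 1 + ε(P + Q)`. -/
theorem IsNonnegSelfAdjoint.add {P Q : H →ₗ.[ℝ] H} (hP : IsNonnegSelfAdjoint P)
    (hQ : IsNonnegSelfAdjoint Q) (hPQ : ∀ x z, (x, z) ∈ Q.graph → (z, 0) ∈ P.graph) :
    IsNonnegSelfAdjoint (P + Q) where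
  symm hx hy := by
    obtain ⟨a, b, ha, hb, rfl⟩ := mem_graph_add.1 hx
    obtain ⟨c, d, hc, hd, rfl⟩ := mem_graph_add.1 hy
    rw [inner_add_left, inner_add_right, hP.symm ha hc, hQ.symm hb hd]
  nonneg hx := by
    obtain ⟨a, b, ha, hb, rfl⟩ := mem_graph_add.1 hx
    rw [inner_add_left]
    exact add_nonneg (hP.nonneg ha) (hQ.nonneg hb)
  range ε hε z := by
    obtain ⟨⟨w, w'⟩, hw, hwz⟩ := hP.range ε hε z
    obtain ⟨⟨v, v'⟩, hv, hvw⟩ := hQ.range ε hε w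
    have h1 := P.graph.sub_mem hw (P.graph.smul_mem ε (hPQ _ _ hv))
    dsimp only at hwz hvw
    rw [Prod.smul_mk, Prod.mk_sub_mk, smul_zero, sub_zero, ← hvw, add_sub_cancel_right] at h1
    refine ⟨(v, w' + v'), mem_graph_add.2 ⟨_, _, h1, hv, rfl⟩, ?_⟩
    dsimp only
    rw [← hwz, ← hvw, smul_add]
    abel

end Abstract

section Hodge

variable {n k : ℕ} {Ω : Set (Eucl n)}

/-! ### The exterior derivative and the Hodge Laplacian -/

/-- Contraction of alternating forms with the `j`-th unit vector, in the first argument. -/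
def contract (n k : ℕ) (j : Fin n) : Alt n (k + 1) →L[ℝ] Alt n k :=
  LinearMap.toContinuousLinearMap
    ((LinearMap.applyₗ (unitVec n j)).comp AlternatingMap.curryLeftLinearMap)

theorem contract_apply (j : Fin n) (a : Alt n (k + 1)) :
    contract n k j a = a.curryLeft (unitVec n j) := rfl

theorem coderiv_eq (φ : Eucl n → Alt n (k + 1)) (x : Eucl n) :
    coderiv φ x = -∑ j : Fin n, contract n k j (fderiv ℝ φ x (unitVec n j)) := rfl

theorem contract_contract (i j : Fin n) (a : Alt n (k + 2)) :
    contract n k i (contract n (k + 1) j a) = -contract n k j (contract n (k + 1) i a) := by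
  simp only [contract_apply]
  have h := AlternatingMap.curryLeft_same a (unitVec n i + unitVec n j)
  simp only [map_add, AlternatingMap.curryLeft_add, LinearMap.add_apply,
    AlternatingMap.curryLeft_same, zero_add, add_zero] at h
  exact eq_neg_of_add_eq_zero_left (by rw [← h])

theorem contDiff_fderiv_apply {φ : Eucl n → Alt n k} (h : ContDiff ℝ ∞ φ) (v : Eucl n) :
    ContDiff ℝ ∞ fun x => fderiv ℝ φ x v :=
  (h.fderiv_right (by simp)).clm_apply contDiff_const

theorem contDiff_coderiv {φ : Eucl n → Alt n (k + 1)} (h : ContDiff ℝ ∞ φ) :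
    ContDiff ℝ ∞ (coderiv φ) :=
  (ContDiff.sum fun j _ =>
    (contract n k j).contDiff.comp (contDiff_fderiv_apply h (unitVec n j))).neg

theorem tsupport_coderiv_subset (φ : Eucl n → Alt n (k + 1)) :
    tsupport (coderiv φ) ⊆ tsupport φ := by
  refine (closure_mono ?_).trans (tsupport_fderiv_subset ℝ)
  intro x hx hx'
  apply hx
  simp [coderiv, hx']

theorem isTestForm_coderiv {φ : Eucl n → Alt n (k + 1)} (h : IsTestForm Ω (k + 1) φ) :
    IsTestForm Ω k (coderiv φ) where
  smooth := contDiff_coderiv h.smooth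
  compact := h.compact.mono' (subset_closure.trans (tsupport_coderiv_subset φ))
  support := (tsupport_coderiv_subset φ).trans h.support

/-- `δδ = 0`: second derivatives are symmetric and contractions anticommute. -/
theorem coderiv_coderiv {φ : Eucl n → Alt n (k + 2)} (h : ContDiff ℝ ∞ φ) (x : Eucl n) :
    coderiv (coderiv φ) x = 0 := by
  have hd : ∀ i, fderiv ℝ (coderiv φ) x (unitVec n i) = -∑ j : Fin n,
      contract n (k + 1) j (fderiv ℝ (fderiv ℝ φ) x (unitVec n i) (unitVec n j)) := fun i => by
    have h1 : ∀ j ∈ Finset.univ, HasFDerivAt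
        (fun y => contract n (k + 1) j (fderiv ℝ φ y (unitVec n j)))
        ((contract n (k + 1) j).comp ((fderiv ℝ (fderiv ℝ φ) x).flip (unitVec n j))) x :=
      fun j _ => by
        have h2 : HasFDerivAt (fderiv ℝ φ) (fderiv ℝ (fderiv ℝ φ) x) x :=
          (((h.fderiv_right (m := ∞) (by simp)).differentiable (by simp)) x).hasFDerivAt
        refine (contract n (k + 1) j).hasFDerivAt.comp x ?_
        have h3 := h2.clm_apply (hasFDerivAt_const (unitVec n j) x)
        simpa using h3
    have h3 := (HasFDerivAt.fun_sum h1).neg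
    rw [HasFDerivAt.fderiv (f := coderiv φ) h3]
    simp
  have hsymm : IsSymmSndFDerivAt ℝ φ x :=
    (h.contDiffAt (x := x)).isSymmSndFDerivAt (by
      rw [minSmoothness_of_isRCLikeNormedField]; exact WithTop.coe_le_coe.2 (le_top : (2 : ℕ∞) ≤ ⊤))
  rw [coderiv_eq]
  simp only [hd, map_neg, map_sum, Finset.sum_neg_distrib, neg_neg]
  set S := ∑ i : Fin n, ∑ j : Fin n, contract n k i (contract n (k + 1) j
    (fderiv ℝ (fderiv ℝ φ) x (unitVec n i) (unitVec n j))) with hS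
  have hneg : S = -S := by
    conv_lhs => rw [hS, Finset.sum_comm]
    rw [hS, ← Finset.sum_neg_distrib]
    refine Finset.sum_congr rfl fun i _ => ?_
    rw [← Finset.sum_neg_distrib]
    refine Finset.sum_congr rfl fun j _ => ?_
    rw [contract_contract, hsymm]
  have h2 : (2 : ℝ) • S = 0 := by
    rw [two_smul]
    nth_rewrite 1 [hneg]
    exact neg_add_cancel S
  exact (smul_eq_zero.1 h2).resolve_left two_ne_zero

theorem integral_inner_eq_inner_toLp (a : L2Form Ω k) {g : Eucl n → Alt n k}
    (hg : MemLp g 2 (volume.restrict Ω)) :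
    ∫ x in Ω, inner ℝ (a x) (g x) = inner ℝ a (hg.toLp g) := by
  rw [L2.inner_def]
  refine integral_congr_ae ?_
  filter_upwards [hg.coeFn_toLp] with x hx
  rw [hx]

theorem isWeakExtDeriv_iff {u : L2Form Ω k} {w : L2Form Ω (k + 1)} :
    IsWeakExtDeriv Ω k u w ↔ ∀ φ (h : IsTestForm Ω (k + 1) φ),
      inner ℝ w (h.memLp.toLp φ) = inner ℝ u (h.memLp_coderiv.toLp (coderiv φ)) := by
  refine forall₂_congr fun φ h => ?_
  rw [integral_inner_eq_inner_toLp w h.memLp, integral_inner_eq_inner_toLp u h.memLp_coderiv]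

theorem isClosed_graph_extD (hΩ : IsOpen Ω) :
    IsClosed ((extD Ω k).graph : Set (L2Form Ω k × L2Form Ω (k + 1))) := by
  have h : ((extD Ω k).graph : Set (L2Form Ω k × L2Form Ω (k + 1))) =
      ⋂ (φ : Eucl n → Alt n (k + 1)) (h : IsTestForm Ω (k + 1) φ),
        {p | inner ℝ p.2 (h.memLp.toLp φ) = inner ℝ p.1 (h.memLp_coderiv.toLp (coderiv φ))} := by
    ext ⟨u, w⟩
    simp only [SetLike.mem_coe, mem_extD_graph hΩ, isWeakExtDeriv_iff, mem_iInter, mem_ofPred_eq]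
  rw [h]
  exact isClosed_iInter fun φ => isClosed_iInter fun h =>
    isClosed_eq (by fun_prop) (by fun_prop)

/-- `dd = 0`. -/
theorem extD_extD {u : L2Form Ω k} {w : L2Form Ω (k + 1)} (hΩ : IsOpen Ω)
    (h : (u, w) ∈ (extD Ω k).graph) : (w, 0) ∈ (extD Ω (k + 1)).graph := by
  rw [mem_extD_graph hΩ] at h ⊢
  intro φ hφ
  rw [h _ (isTestForm_coderiv hφ)]
  simp only [coderiv_coderiv hφ.smooth, inner_zero_right, integral_zero]
  rw [integral_inner_eq_inner_toLp _ hφ.memLp, inner_zero_left]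

/-- A form orthogonal to all test forms vanishes. -/
theorem eq_zero_of_forall_testForm (hΩ : IsOpen Ω) {w : L2Form Ω k}
    (h : ∀ φ (hφ : IsTestForm Ω k φ), inner ℝ w (hφ.memLp.toLp φ) = 0) : w = 0 := by
  have hloc : LocallyIntegrableOn w Ω volume :=
    locallyIntegrableOn_of_locallyIntegrable_restrict
      ((Lp.memLp w).locallyIntegrable (by norm_num))
  have hz : ∀ᵐ x ∂(volume : Measure (Eucl n)), x ∈ Ω → w x = 0 := by
    refine hΩ.ae_eq_zero_of_integral_contDiff_smul_eq_zero hloc fun g hg hgc hgs => ?_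
    have hT : ∀ c : Alt n k, IsTestForm Ω k (fun x => g x • c) := fun c =>
      ⟨hg.smul contDiff_const, hgc.smul_right, (tsupport_smul_subset_left g _).trans hgs⟩
    rw [← setIntegral_eq_integral_of_forall_compl_eq_zero (s := Ω) (fun x hx => by
      rw [image_eq_zero_of_notMem_tsupport (fun h' => hx (hgs h')), zero_smul])]
    have hint : Integrable (fun x => g x • w x) (volume.restrict Ω) :=
      memLp_one_iff_integrable.1 ((Lp.memLp w).smul (p := 2) (q := 2) (r := 1)
        ((hg.continuous.memLp_of_hasCompactSupport hgc).restrict Ω))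
    refine ext_inner_right ℝ fun c => ?_
    rw [inner_zero_left, real_inner_comm, ← integral_inner hint c, ← h _ (hT c),
      ← integral_inner_eq_inner_toLp w (hT c).memLp]
    refine integral_congr_ae (Filter.Eventually.of_forall fun x => ?_)
    simp only [real_inner_smul_right]
    rw [real_inner_comm]
  refine (Lp.eq_zero_iff_ae_eq_zero).2 ?_
  exact (ae_restrict_iff' hΩ.measurableSet).2 hz

/-- The classical exterior derivative of a smooth form, written through the adjoints of the
contractions, which are the exterior products with the coordinate forms. -/
def smoothExtDeriv (φ : Eucl n → Alt n k) (x : Eucl n) : Alt n (k + 1) :=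
  ∑ j : Fin n, (contract n k j).adjoint (fderiv ℝ φ x (unitVec n j))

theorem IsTestForm.memLp_smoothExtDeriv {φ : Eucl n → Alt n k} (h : IsTestForm Ω k φ) :
    MemLp (smoothExtDeriv φ) 2 (volume.restrict Ω) := by
  have hc : Continuous (smoothExtDeriv φ) :=
    continuous_finsetSum _ fun j _ =>
      (contract n k j).adjoint.continuous.comp (contDiff_fderiv_apply h.smooth _).continuous
  have hs : HasCompactSupport (smoothExtDeriv φ) := by
    refine (h.compact.fderiv ℝ).mono ?_
    intro x hx hx'
    apply hx
    simp [smoothExtDeriv, hx']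
  exact (hc.memLp_of_hasCompactSupport hs).restrict Ω

/-- Integration by parts for compactly supported smooth forms. -/
theorem integral_inner_smoothExtDeriv {φ : Eucl n → Alt n k} {ψ : Eucl n → Alt n (k + 1)}
    (hφ : IsTestForm Ω k φ) (hψ : IsTestForm Ω (k + 1) ψ) :
    ∫ x, inner ℝ (smoothExtDeriv φ x) (ψ x) = ∫ x, inner ℝ (φ x) (coderiv ψ x) := by
  have hφd : ∀ j, Continuous fun x => fderiv ℝ φ x (unitVec n j) := fun j =>
    (contDiff_fderiv_apply hφ.smooth _).continuous
  have hψd : ∀ j, Continuous fun x => contract n k j (fderiv ℝ ψ x (unitVec n j)) := fun j =>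
    (contract n k j).continuous.comp (contDiff_fderiv_apply hψ.smooth _).continuous
  have hψc : ∀ j, Continuous fun x => contract n k j (ψ x) := fun j =>
    (contract n k j).continuous.comp hψ.smooth.continuous
  -- Every integrand is continuous with compact support.
  have i1 : ∀ j, Integrable fun x =>
      (inner ℝ (fderiv ℝ φ x (unitVec n j)) (contract n k j (ψ x)) : ℝ) := fun j => by
    refine ((hφd j).inner (hψc j)).integrable_of_hasCompactSupport
      (hψ.compact.mono fun x hx hx' => hx ?_)
    simp [hx']
  have i2 : ∀ j, Integrable fun x =>
      (inner ℝ (φ x) (contract n k j (fderiv ℝ ψ x (unitVec n j))) : ℝ) := fun j => by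
    refine (hφ.smooth.continuous.inner (hψd j)).integrable_of_hasCompactSupport
      (hφ.compact.mono fun x hx hx' => hx ?_)
    simp [hx']
  have i3 : ∀ j, Integrable fun x => (inner ℝ (φ x) (contract n k j (ψ x)) : ℝ) := fun j => by
    refine (hφ.smooth.continuous.inner (hψc j)).integrable_of_hasCompactSupport
      (hφ.compact.mono fun x hx hx' => hx ?_)
    simp [hx']
  have hparts : ∀ j, ∫ x, (inner ℝ (φ x) (contract n k j (fderiv ℝ ψ x (unitVec n j))) : ℝ) =
      -∫ x, (inner ℝ (fderiv ℝ φ x (unitVec n j)) (contract n k j (ψ x)) : ℝ) := fun j => by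
    have hψdiff : Differentiable ℝ ψ := hψ.smooth.differentiable (by simp)
    have hd : ∀ x, fderiv ℝ (fun y => contract n k j (ψ y)) x (unitVec n j) =
        contract n k j (fderiv ℝ ψ x (unitVec n j)) := fun x => by
      rw [HasFDerivAt.fderiv (f := fun y => contract n k j (ψ y))
        ((contract n k j).hasFDerivAt.comp x (hψdiff x).hasFDerivAt)]
      rfl
    have h := integral_bilinear_fderiv_right_eq_neg_left_of_integrable (μ := volume)
      (f := φ) (g := fun y => contract n k j (ψ y)) (v := unitVec n j) (B := innerSL ℝ)
      (i1 j) (by simp only [hd]; exact i2 j) (i3 j)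
      (fun x _ => hφ.smooth.differentiable (by simp) x)
      (fun x _ => (contract n k j).differentiableAt.comp x (hψdiff x))
    simp only [hd] at h
    exact h
  simp only [smoothExtDeriv, coderiv_eq, sum_inner, inner_neg_right, inner_sum,
    ContinuousLinearMap.adjoint_inner_left]
  rw [integral_neg, integral_finsetSum _ fun j _ => i1 j, integral_finsetSum _ fun j _ => i2 j,
    ← Finset.sum_neg_distrib]
  exact Finset.sum_congr rfl fun j _ => by rw [hparts, neg_neg]

theorem IsTestForm.toLp_mem_domain (hΩ : IsOpen Ω) {φ : Eucl n → Alt n k}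
    (h : IsTestForm Ω k φ) : h.memLp.toLp φ ∈ (extD Ω k).domain := by
  refine LinearPMap.mem_domain_of_mem_graph (y := h.memLp_smoothExtDeriv.toLp _)
    ((mem_extD_graph hΩ _ _).2 fun ψ hψ => ?_)
  have h1 : ∫ x in Ω, inner ℝ (h.memLp_smoothExtDeriv.toLp (smoothExtDeriv φ) x) (ψ x) =
      ∫ x in Ω, inner ℝ (smoothExtDeriv φ x) (ψ x) := by
    refine integral_congr_ae ?_
    filter_upwards [h.memLp_smoothExtDeriv.coeFn_toLp] with x hx
    rw [hx]
  have h2 : ∫ x in Ω, inner ℝ (h.memLp.toLp φ x) (coderiv ψ x) =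
      ∫ x in Ω, inner ℝ (φ x) (coderiv ψ x) := by
    refine integral_congr_ae ?_
    filter_upwards [h.memLp.coeFn_toLp] with x hx
    rw [hx]
  rw [h1, h2, setIntegral_eq_integral_of_forall_compl_eq_zero,
    setIntegral_eq_integral_of_forall_compl_eq_zero, integral_inner_smoothExtDeriv h hψ]
  · intro x hx
    rw [image_eq_zero_of_notMem_tsupport (fun h' => hx (h.support h')), inner_zero_left]
  · intro x hx
    rw [image_eq_zero_of_notMem_tsupport (fun h' => hx (hψ.support h')), inner_zero_right]

theorem dense_domain_extD (hΩ : IsOpen Ω) : Dense ((extD Ω k).domain : Set (L2Form Ω k)) := by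
  rw [Submodule.dense_iff_topologicalClosure_eq_top, Submodule.topologicalClosure_eq_top_iff,
    Submodule.eq_bot_iff]
  intro w hw
  exact eq_zero_of_forall_testForm hΩ fun φ hφ =>
    (Submodule.mem_orthogonal' _ _).1 hw _ (hφ.toLp_mem_domain hΩ)

theorem isNonnegSelfAdjoint_extDExtDStar (hΩ : IsOpen Ω) :
    IsNonnegSelfAdjoint (extDExtDStar Ω k) := by
  cases k with
  | zero => exact isNonnegSelfAdjoint_zero
  | succ k =>
    exact isNonnegSelfAdjoint_self_comp_adjoint (dense_domain_extD hΩ) (isClosed_graph_extD hΩ)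

/-- `(dd*)(d*d) = 0`, as `d*d* = 0`. -/
theorem extDExtDStar_of_mem_graph (hΩ : IsOpen Ω) {x z : L2Form Ω k}
    (h : (x, z) ∈ (pcomp (extDStar Ω k) (extD Ω k)).graph) :
    (z, 0) ∈ (extDExtDStar Ω k).graph := by
  cases k with
  | zero => exact (LinearPMap.mem_graph_iff _).2 ⟨⟨z, trivial⟩, rfl, rfl⟩
  | succ k =>
    obtain ⟨y, -, hyz⟩ := (mem_pcomp_graph _ _ _ _).1 h
    refine (mem_pcomp_graph _ _ _ _).2 ⟨0, ?_, (extD Ω k).graph.zero_mem⟩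
    refine (mem_graph_adjoint (dense_domain_extD hΩ)).2 fun a a' ha => ?_
    rw [(mem_graph_adjoint (dense_domain_extD hΩ)).1 hyz _ _ (extD_extD hΩ ha), inner_zero_left,
      inner_zero_right]

theorem isNonnegSelfAdjoint_hodgeLaplacian (hΩ : IsOpen Ω) :
    IsNonnegSelfAdjoint (hodgeLaplacian Ω k) :=
  (isNonnegSelfAdjoint_extDExtDStar hΩ).add
    (isNonnegSelfAdjoint_adjoint_comp_self (dense_domain_extD hΩ) (isClosed_graph_extD hΩ))
    fun _ _ h => extDExtDStar_of_mem_graph hΩ h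

end Hodge

end

end HodgeHeat

theorem theorem4p3 {n : ℕ} (Ω : Set (HodgeHeat.Eucl n)) (hΩ : IsOpen Ω) (k : ℕ)
    (T : ℝ) (hT : 0 < T) (u₀ : HodgeHeat.L2Form Ω k) (f : ℝ → HodgeHeat.L2Form Ω k)
    (hf : ContinuousOn f (Icc 0 T))
    (hf' : HodgeHeat.MemL1 (HodgeHeat.hodgeLaplacian Ω k) (Ioo 0 T) f ∨
      HodgeHeat.MemW11 (Ioo 0 T) f)
    (hfC : HodgeHeat.MemC (HodgeHeat.hodgeLaplacian Ω k) (Ioc 0 T) f)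
    (hfL : HodgeHeat.MemL1
      (HodgeHeat.pcomp (HodgeHeat.hodgeLaplacian Ω k) (HodgeHeat.hodgeLaplacian Ω k))
      (Ioo 0 T) f) :
    ∃ u : ℝ → HodgeHeat.L2Form Ω k,
      HodgeHeat.IsSolution (HodgeHeat.hodgeLaplacian Ω k) T f u₀ u ∧
      (∀ v : ℝ → HodgeHeat.L2Form Ω k,
        HodgeHeat.IsSolution (HodgeHeat.hodgeLaplacian Ω k) T f u₀ v → EqOn v u (Icc 0 T)) ∧
      HodgeHeat.MemC1 (HodgeHeat.hodgeLaplacian Ω k) (Ioc 0 T) u := by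
  exact (HodgeHeat.isNonnegSelfAdjoint_hodgeLaplacian hΩ).exists_solution_contDiffOn
    hT u₀ hf hfC hfL
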